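/- For elements $a,x$ of the field $\mathbb{Q}(q)$ let $(a;x)_m=\prod_{i=0}^{m-1}(1-ax^i)$ (so $(a;x)_0=1$), let $[m]_x=(1-x^m)/(1-x)$ for $x\ne 1$, and let $\Phi_m(q)$ be the $m$-th cyclotomic polynomial. For rational functions $A(q),B(q)\in\mathbb{Q}(q)$ and a polynomial $P(q)\in\mathbb{Z}[q]$, write $A(q)\equiv B(q)\pmod{P(q)}$ if, when $A(q)-B(q)$ is written as a reduced fraction of polynomials in $\mathbb{Z}[q]$, its numerator is divisible by $P(q)$ in $\mathbb{Z}[q]$. Theorem. Let $n$ be a positive integer with $n\equiv 1\pmod 4$, let $r\ge 1$ be an integer, and let $d\in\{1,2\}$. Then, modulo $\Phi_{n^r}(q)\prod_{j=1}^{r}\Phi_{n^j}(q)$, $$ \sum_{k=0}^{(n^r-1)/d}\frac{(1+q^{4k+1})\,(q^2;q^4)_k^3}{(1+q)\,(q^4;q^4)_k^3}\,q^{k} \equiv \frac{[n]_{q^2}\,(q^3;q^4)_{(n^r-1)/2}\,(q^{5n};q^{4n})_{(n^{r-1}-1)/2}}{(q^5;q^4)_{(n^r-1)/2}\,(q^{3n};q^{4n})_{(n^{r-1}-1)/2}}\,q^{(1-n)/2}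 \sum_{k=0}^{(n^{r-1}-1)/d}\frac{(1+q^{(4k+1)n})\,(q^{2n};q^{4n})_k^3}{(1+q^n)\,(q^{4n};q^{4n})_k^3}\,q^{nk}. $$ -/

import Mathlib

open Polynomial

/-- The `q`-shifted factorial `(a; q)_m = (1 - a) (1 - a q) ⋯ (1 - a q^(m-1))`, with `(a; q)_0 = 1`. -/
def qShifted {R : Type*} [CommRing R] (a q : R) (m : ℕ) : R :=
  ∏ i ∈ Finset.range m, (1 - a * q ^ i)

/-- The `q`-integer `[m]_q = (1 - q^m) / (1 - q)`. -/
def qInteger {F : Type*} [Field F] (m : ℕ) (q : F) : F :=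
  (1 - q ^ m) / (1 - q)

/-- `A ≡ B (mod P)` for rational functions `A`, `B` in one variable (elements of the fraction field
of `ℤ[q]`) and a polynomial `P ∈ ℤ[q]`: the numerator of the reduced fraction `A - B` is divisible
by `P` in `ℤ[q]`. -/
def RatFuncCongr (A B : RatFunc ℤ) (P : ℤ[X]) : Prop :=
  P ∣ IsFractionRing.num ℤ[X] (A - B)

/-! Everything is measured by the `Φ_m`-adic valuation with `m = n ^ j`, in whose residue field `q`
becomes a root of unity of odd order `m`.

Second order, at `m = n ^ r`: multiply one of the three equal parameters by `w = Q ^ (2 * M)` and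
another by `w⁻¹`. The pair is symmetric, so the summands change only by multiples of `(1 - w) ^ 2`,
which is invisible modulo `Φ_m ^ 2`. The deformed series is a terminating very-well-poised `₆φ₅`,
hence has a product formula (`sum_deformedSummand`). Thus the left sum and the sum in `q ^ n` are
both congruent to closed forms, and these differ exactly by the stated prefactor
(`dworkFactor_mul_closedForm`).

First order, at `m = n ^ j` with `j < r`: a `q`-Lucas congruence cuts each sum into periods, giving
the closed form for one period times `∑ shiftedRatio (Q ^ M) u ^ 3`
(`map_sum_cubicSummand_sub_mul_lt`). For base `q` with period `n ^ j` and base `q ^ n` with period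
`n ^ (j - 1)` the power `Q ^ M` is the same, so this second factor is common to both. The prefactor
reduces to that of a single period (`dworkFactor_principalEquiv`), and the closed-form identity
applies again.

Distinct cyclotomic polynomials are relatively prime, so the separate divisibilities multiply. -/

section QShifted

variable {R : Type*} [CommRing R]

lemma qShifted_zero (a q : R) : qShifted a q 0 = 1 := by simp [qShifted]

lemma qShifted_succ (a q : R) (m : ℕ) :
    qShifted a q (m + 1) = qShifted a q m * (1 - a * q ^ m) :=
  Finset.prod_range_succ _ _

lemma qShifted_succ' (a q : R) (m : ℕ) :
    qShifted a q (m + 1) = (1 - a) * qShifted (a * q) q m := by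
  simp only [qShifted]
  rw [Finset.prod_range_succ', mul_comm]
  congr 1
  · simp
  · refine Finset.prod_congr rfl fun i _ => ?_
    ring

lemma qShifted_add (a q : R) (m k : ℕ) :
    qShifted a q (m + k) = qShifted a q m * qShifted (a * q ^ m) q k := by
  simp only [qShifted, Finset.prod_range_add]
  congr 1
  refine Finset.prod_congr rfl fun i _ => ?_
  ring

end QShifted

/-! ### The terminating `₆φ₅` summation, by a contiguous relation. -/

section VeryWellPoised

variable {F : Type*} [Field F]

/-- The summand of the very-well-poised series `₆φ₅` with parameters `a`, `b`, `c`, `x⁻¹`,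
multiplied by `1 - a`; the series terminates when `x` is a power of `q`. -/
def sixPhiFiveTerm (a b c q x : F) (k : ℕ) : F :=
  (1 - a * q ^ (2 * k)) * (qShifted a q k * qShifted b q k * qShifted c q k * qShifted x⁻¹ q k)
    / (qShifted q q k * qShifted (a * q / b) q k * qShifted (a * q / c) q k
        * qShifted (a * q * x) q k) * (a * q * x / (b * c)) ^ k

lemma qShifted_ne_zero {a q : F} {m : ℕ} (h : ∀ i < m, a * q ^ i ≠ 1) : qShifted a q m ≠ 0 :=
  Finset.prod_ne_zero_iff.2 fun i hi => sub_ne_zero.2 (h i (Finset.mem_range.1 hi)).symm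

/-- A contiguous relation between the series at `x * q` and at `x`, with an explicit antidifference.
At `x = q ^ n` the factor `qShifted x⁻¹ q m` kills the right side once `m > n`, which leaves a
first-order recurrence in `n` for the full sums. -/
lemma sixPhiFiveTerm_telescope {a b c q x : F} (hb : b ≠ 0) (hc : c ≠ 0) (hq : q ≠ 0) (hx : x ≠ 0)
    (h1 : ∀ i, q * q ^ i ≠ 1) (h2 : ∀ i, a * q / b * q ^ i ≠ 1) (h3 : ∀ i, a * q / c * q ^ i ≠ 1)
    (h4 : ∀ i, a * q * x * q ^ i ≠ 1) (m : ℕ) :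
    ∑ k ∈ Finset.range (m + 1),
      ((1 - a * q * x / b) * (1 - a * q * x / c) * sixPhiFiveTerm a b c q (x * q) k
        - (1 - a * q * x) * (1 - a * q * x / (b * c)) * sixPhiFiveTerm a b c q x k)
      = (1 - a * q * x) * (qShifted a q (m + 1) * qShifted b q (m + 1) * qShifted c q (m + 1)
          * qShifted x⁻¹ q m) / (qShifted q q m * qShifted (a * q / b) q m
          * qShifted (a * q / c) q m * qShifted (a * q * x) q (m + 1))
          * (a * q * x / (b * c)) ^ (m + 1) := by
  induction m with
  | zero =>
    have := sub_ne_zero.2 (h4 0).symm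
    simp only [pow_zero, mul_one] at this
    simp [sixPhiFiveTerm, qShifted_succ, qShifted_zero]
    field_simp
    ring
  | succ m ih =>
    rw [Finset.sum_range_succ, ih]
    have e1 : qShifted (x * q)⁻¹ q (m + 1) = (1 - (x * q)⁻¹) * qShifted x⁻¹ q m := by
      rw [qShifted_succ']
      congr 2
      field_simp
    have e2 : qShifted (a * q * (x * q)) q (m + 1)
        = qShifted (a * q * x) q (m + 1) * (1 - a * q * x * q ^ (m + 1)) / (1 - a * q * x) := by
      have h := sub_ne_zero.2 (h4 0).symm
      simp only [pow_zero, mul_one] at h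
      rw [← qShifted_succ, qShifted_succ' _ _ (m + 1), mul_div_cancel_left₀ _ h]
      congr 1
      ring
    have n0 := sub_ne_zero.2 (h4 0).symm
    have n1 := sub_ne_zero.2 (h1 m).symm
    have n2 := sub_ne_zero.2 (h2 m).symm
    have n3 := sub_ne_zero.2 (h3 m).symm
    have n4 := sub_ne_zero.2 (h4 (m + 1)).symm
    have d1 : qShifted q q m ≠ 0 := qShifted_ne_zero fun i _ => h1 i
    have d2 : qShifted (a * q / b) q m ≠ 0 := qShifted_ne_zero fun i _ => h2 i
    have d3 : qShifted (a * q / c) q m ≠ 0 := qShifted_ne_zero fun i _ => h3 i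
    have d4 : qShifted (a * q * x) q (m + 1) ≠ 0 := qShifted_ne_zero fun i _ => h4 i
    simp only [sixPhiFiveTerm, e1, e2]
    rw [qShifted_succ (a * q * x) q (m + 1), qShifted_succ a q (m + 1), qShifted_succ b q (m + 1),
      qShifted_succ c q (m + 1), qShifted_succ x⁻¹ q m, qShifted_succ q q m,
      qShifted_succ (a * q / b) q m, qShifted_succ (a * q / c) q m]
    have p1 : q ^ (2 * (m + 1)) = (q ^ m) ^ 2 * q ^ 2 := by ring
    have p2 : (a * q * (x * q) / (b * c)) ^ (m + 1)
        = (a * q * x / (b * c)) ^ (m + 1) * (q ^ m * q) := by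
      rw [← pow_succ, ← mul_pow]; congr 1; ring
    rw [p1, p2, pow_succ (a * q * x / (b * c)) (m + 1)]
    simp only [pow_succ q m, pow_zero, mul_one] at *
    generalize (a * q * x / (b * c)) ^ (m + 1) = Z
    generalize qShifted a q (m + 1) = A
    generalize qShifted b q (m + 1) = B
    generalize qShifted c q (m + 1) = C
    generalize qShifted x⁻¹ q m = X at *
    generalize qShifted q q m = D1 at *
    generalize qShifted (a * q / b) q m = D2 at *
    generalize qShifted (a * q / c) q m = D3 at *
    generalize qShifted (a * q * x) q (m + 1) = D4 at *
    clear ih e1 e2 p1 p2 h1 h2 h3 h4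
    generalize q ^ m = y at *
    have n2' : b - a * q * y ≠ 0 := by
      intro h; apply n2; field_simp; linear_combination h
    have n3' : c - a * q * y ≠ 0 := by
      intro h; apply n3; field_simp; linear_combination h
    have n4' : 1 - a * q ^ 2 * x * y ≠ 0 := by
      intro h; apply n4; linear_combination h
    field_simp
    ring

/-- The terminating very-well-poised `₆φ₅` summation. -/
theorem sum_sixPhiFiveTerm {a b c q : F} (hb : b ≠ 0) (hc : c ≠ 0) (hq : q ≠ 0)
    (h1 : ∀ i, q * q ^ i ≠ 1) (h2 : ∀ i, a * q / b * q ^ i ≠ 1) (h3 : ∀ i, a * q / c * q ^ i ≠ 1)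
    (h4 : ∀ i, a * q * q ^ i ≠ 1) (n : ℕ) :
    ∑ k ∈ Finset.range (n + 1), sixPhiFiveTerm a b c q (q ^ n) k
      = (1 - a) * (qShifted (a * q) q n * qShifted (a * q / (b * c)) q n)
        / (qShifted (a * q / b) q n * qShifted (a * q / c) q n) := by
  induction n with
  | zero => simp [sixPhiFiveTerm, qShifted_zero]
  | succ n ih =>
    -- The sum is taken one term past the natural end of the series at `q ^ n`: the extra term
    -- vanishes there, and so does the boundary term.
    have hz : qShifted (q ^ n)⁻¹ q (n + 1) = 0 := by
      rw [qShifted_succ, inv_mul_cancel₀ (pow_ne_zero n hq), sub_self, mul_zero]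
    have ht : sixPhiFiveTerm a b c q (q ^ n) (n + 1) = 0 := by
      simp [sixPhiFiveTerm, hz]
    have key := sixPhiFiveTerm_telescope hb hc hq (pow_ne_zero n hq) h1 h2 h3
      (fun i => by have := h4 (n + i); rwa [pow_add, ← mul_assoc] at this) (n + 1)
    rw [hz, Finset.sum_sub_distrib, ← Finset.mul_sum, ← Finset.mul_sum,
      Finset.sum_range_succ (sixPhiFiveTerm a b c q (q ^ n)), ht, add_zero, ih, ← pow_succ] at key
    have n2 := sub_ne_zero.2 (h2 n).symm
    have n3 := sub_ne_zero.2 (h3 n).symm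
    have d2 : qShifted (a * q / b) q n ≠ 0 := qShifted_ne_zero fun i _ => h2 i
    have d3 : qShifted (a * q / c) q n ≠ 0 := qShifted_ne_zero fun i _ => h3 i
    have e2 : 1 - a * q * q ^ n / b = 1 - a * q / b * q ^ n := by ring
    have e3 : 1 - a * q * q ^ n / c = 1 - a * q / c * q ^ n := by ring
    have e4 : 1 - a * q * q ^ n / (b * c) = 1 - a * q / (b * c) * q ^ n := by ring
    rw [e2, e3, e4, mul_zero, mul_zero, zero_div, zero_mul, sub_eq_zero] at key
    refine mul_left_cancel₀ (mul_ne_zero n2 n3) (key.trans ?_)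
    rw [qShifted_succ (a * q), qShifted_succ (a * q / (b * c)), qShifted_succ (a * q / b),
      qShifted_succ (a * q / c)]
    generalize qShifted (a * q / b) q n = D2 at *
    generalize qShifted (a * q / c) q n = D3 at *
    generalize 1 - a * q / b * q ^ n = e at *
    generalize 1 - a * q / c * q ^ n = f at *
    field_simp

end VeryWellPoised

/-! ### Multiplicative congruence, which still makes sense for products with non-unit factors. -/

section PrincipalUnits

variable {K Γ₀ : Type*} [Field K] [LinearOrderedCommGroupWithZero Γ₀] {v : Valuation K Γ₀}

/-- `x` and `y` differ by a factor which is a principal unit for the valuation `v`. -/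
def PrincipalEquiv (v : Valuation K Γ₀) (x y : K) : Prop :=
  v (x - y) < v y

namespace PrincipalEquiv

variable {x y z x' y' : K}

lemma refl (v : Valuation K Γ₀) (hx : x ≠ 0) : PrincipalEquiv v x x := by
  simpa [PrincipalEquiv] using zero_lt_iff.2 ((Valuation.ne_zero_iff v).2 hx)

lemma map_eq (h : PrincipalEquiv v x y) : v x = v y :=
  Valuation.map_eq_of_sub_lt v h

lemma pos (h : PrincipalEquiv v x y) : 0 < v y :=
  lt_of_le_of_lt zero_le h

lemma symm (h : PrincipalEquiv v x y) : PrincipalEquiv v y x := by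
  rw [PrincipalEquiv, Valuation.map_sub_swap, h.map_eq]
  exact h

lemma trans (h : PrincipalEquiv v x y) (h' : PrincipalEquiv v y z) : PrincipalEquiv v x z := by
  have := Valuation.map_add_lt v (h'.map_eq ▸ h : v (x - y) < v z) h'
  rwa [sub_add_sub_cancel] at this

lemma mul (h : PrincipalEquiv v x y) (h' : PrincipalEquiv v x' y') :
    PrincipalEquiv v (x * x') (y * y') := by
  have e : x * x' - y * y' = (x - y) * x' + y * (x' - y') := by ring
  rw [PrincipalEquiv, e, map_mul]
  refine Valuation.map_add_lt v ?_ ?_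
  · rw [map_mul, h'.map_eq]
    exact mul_lt_mul_of_pos_right h h'.pos
  · rw [map_mul]
    exact mul_lt_mul_of_pos_left h' h.pos

lemma inv (h : PrincipalEquiv v x y) : PrincipalEquiv v x⁻¹ y⁻¹ := by
  have hy : y ≠ 0 := (Valuation.pos_iff v).1 h.pos
  have hx : x ≠ 0 := (Valuation.pos_iff v).1 h.symm.pos
  have e : x⁻¹ - y⁻¹ = (y - x) * (x⁻¹ * y⁻¹) := by field_simp
  have h0 : 0 < (v y)⁻¹ := inv_pos.2 h.pos
  rw [PrincipalEquiv, e, map_mul, map_mul, map_inv₀, map_inv₀, h.map_eq, Valuation.map_sub_swap]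
  calc v (x - y) * ((v y)⁻¹ * (v y)⁻¹) < v y * ((v y)⁻¹ * (v y)⁻¹) :=
        mul_lt_mul_of_pos_right h (mul_pos h0 h0)
    _ = (v y)⁻¹ := by rw [← mul_assoc, mul_inv_cancel₀ h.pos.ne', one_mul]

lemma div (h : PrincipalEquiv v x y) (h' : PrincipalEquiv v x' y') :
    PrincipalEquiv v (x / x') (y / y') := by
  rw [div_eq_mul_inv, div_eq_mul_inv]
  exact h.mul h'.inv

lemma prod {ι : Type*} (s : Finset ι) (f g : ι → K) (h : ∀ i ∈ s, PrincipalEquiv v (f i) (g i)) :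
    PrincipalEquiv v (∏ i ∈ s, f i) (∏ i ∈ s, g i) := by
  classical
  induction s using Finset.induction_on with
  | empty => simpa using refl v one_ne_zero
  | insert a s ha ih =>
    rw [Finset.prod_insert ha, Finset.prod_insert ha]
    exact (h a (Finset.mem_insert_self a s)).mul
      (ih fun i hi => h i (Finset.mem_insert_of_mem hi))

end PrincipalEquiv

end PrincipalUnits

/-! ### Additive congruence `v (x - y) < δ`; a variable `δ` serves first and second order alike. -/

section ValuationCongruence

variable {K Γ₀ : Type*} [Field K] [LinearOrderedCommGroupWithZero Γ₀] {v : Valuation K Γ₀}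
  {δ : Γ₀} {x y x' y' z : K}

lemma Valuation.map_mul_sub_mul_lt (hx' : v x' ≤ 1) (hy : v y ≤ 1) (h : v (x - y) < δ)
    (h' : v (x' - y') < δ) : v (x * x' - y * y') < δ := by
  have e : x * x' - y * y' = (x - y) * x' + y * (x' - y') := by ring
  rw [e]
  refine Valuation.map_add_lt v ?_ ?_ <;> rw [map_mul]
  · exact lt_of_le_of_lt (mul_le_of_le_one_right' hx') h
  · exact lt_of_le_of_lt (mul_le_of_le_one_left' hy) h'

lemma Valuation.map_inv_sub_inv_lt (hx : v x = 1) (hy : v y = 1) (h : v (x - y) < δ) :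
    v (x⁻¹ - y⁻¹) < δ := by
  have hx0 : x ≠ 0 := fun h0 => by simp [h0] at hx
  have hy0 : y ≠ 0 := fun h0 => by simp [h0] at hy
  have e : x⁻¹ - y⁻¹ = (y - x) * (x⁻¹ * y⁻¹) := by field_simp
  rw [e, map_mul, map_mul, map_inv₀, map_inv₀, hx, hy, Valuation.map_sub_swap]
  simpa using h

lemma Valuation.map_div_sub_div_lt (hy : v y ≤ 1) (hx' : v x' = 1) (hy' : v y' = 1)
    (h : v (x - y) < δ) (h' : v (x' - y') < δ) : v (x / x' - y / y') < δ := by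
  rw [div_eq_mul_inv, div_eq_mul_inv]
  exact Valuation.map_mul_sub_mul_lt (by simp [hx']) hy h (Valuation.map_inv_sub_inv_lt hx' hy' h')

lemma Valuation.map_sub_lt_trans (h : v (x - y) < δ) (h' : v (y - z) < δ) : v (x - z) < δ := by
  simpa using Valuation.map_add_lt v h h'

lemma Valuation.map_prod_le_one {ι : Type*} (s : Finset ι) (f : ι → K) (h : ∀ i ∈ s, v (f i) ≤ 1) :
    v (∏ i ∈ s, f i) ≤ 1 := by
  rw [map_prod]
  exact Finset.prod_le_one' h

lemma Valuation.map_prod_eq_one {ι : Type*} (s : Finset ι) (f : ι → K) (h : ∀ i ∈ s, v (f i) = 1) :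
    v (∏ i ∈ s, f i) = 1 := by
  rw [map_prod]
  exact Finset.prod_eq_one h

lemma Valuation.map_sum_sub_sum_lt {ι : Type*} (hδ : 0 < δ) (s : Finset ι) (f g : ι → K)
    (h : ∀ i ∈ s, v (f i - g i) < δ) : v (∑ i ∈ s, f i - ∑ i ∈ s, g i) < δ := by
  rw [← Finset.sum_sub_distrib]
  exact Valuation.map_sum_lt' v hδ h

lemma Valuation.map_prod_sub_prod_lt {ι : Type*} (hδ : 0 < δ) (s : Finset ι) (f g : ι → K)
    (hf : ∀ i ∈ s, v (f i) ≤ 1) (hg : ∀ i ∈ s, v (g i) ≤ 1) (h : ∀ i ∈ s, v (f i - g i) < δ) :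
    v (∏ i ∈ s, f i - ∏ i ∈ s, g i) < δ := by
  classical
  induction s using Finset.induction_on with
  | empty => simpa using hδ
  | insert a s ha ih =>
    rw [Finset.prod_insert ha, Finset.prod_insert ha]
    refine Valuation.map_mul_sub_mul_lt
      (Valuation.map_prod_le_one s f fun i hi => hf i (Finset.mem_insert_of_mem hi))
      (hg a (Finset.mem_insert_self a s)) (h a (Finset.mem_insert_self a s))
      (ih (fun i hi => hf i (Finset.mem_insert_of_mem hi))
        (fun i hi => hg i (Finset.mem_insert_of_mem hi))
        fun i hi => h i (Finset.mem_insert_of_mem hi))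

lemma Valuation.map_pow_sub_pow_lt (hδ : 0 < δ) (hx : v x ≤ 1) (hy : v y ≤ 1)
    (h : v (x - y) < δ) (n : ℕ) : v (x ^ n - y ^ n) < δ := by
  simpa using Valuation.map_prod_sub_prod_lt hδ (Finset.range n) (fun _ => x) (fun _ => y)
    (fun _ _ => hx) (fun _ _ => hy) fun _ _ => h

lemma PrincipalEquiv.map_sub_lt_one (h : PrincipalEquiv v x y) (hy : v y ≤ 1) : v (x - y) < 1 :=
  lt_of_lt_of_le h hy

end ValuationCongruence

lemma qShifted_pow_pow {R : Type*} [CommRing R] (Q : R) (c e m : ℕ) :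
    qShifted (Q ^ c) (Q ^ e) m = ∏ i ∈ Finset.range m, (1 - Q ^ (c + e * i)) :=
  Finset.prod_congr rfl fun i _ => by rw [pow_add, pow_mul]

/-! ### Arithmetic at a root of unity and the `q`-Lucas theorem. -/

section RootOfUnityAt

variable {K Γ₀ : Type*} [Field K] [LinearOrderedCommGroupWithZero Γ₀]

/-- `Q` has infinite order, but reduces to a root of unity of odd order `M` in the residue field
of `v`, which has characteristic zero. -/
structure ReducesToRootOfUnity (v : Valuation K Γ₀) (Q : K) (M : ℕ) : Prop where
  odd : Odd M
  map_eq_one : v Q = 1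
  map_one_sub_pow : ∀ t, ¬ M ∣ t → v (1 - Q ^ t) = 1
  map_one_sub_lt : v (1 - Q ^ M) < 1
  pow_ne_one : ∀ t, t ≠ 0 → Q ^ t ≠ 1
  map_natCast : ∀ t : ℕ, t ≠ 0 → v (t : K) = 1

/-- The quotient `(1 - w ^ s) / (1 - w)` is a geometric sum congruent to `s`, a unit by hypothesis.
-/
lemma Valuation.map_one_sub_pow_of_lt {v : Valuation K Γ₀} {w : K} (hw : v (1 - w) < 1)
    (h : ∀ t : ℕ, t ≠ 0 → v (t : K) = 1) {s : ℕ} (hs : s ≠ 0) : v (1 - w ^ s) = v (1 - w) := by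
  have hw1 : v w ≤ 1 := by
    have := Valuation.map_sub_le v (x := 1) (y := 1 - w) (g := 1) (by simp) hw.le
    simpa using this
  have h1 : v (∑ i ∈ Finset.range s, w ^ i - ∑ i ∈ Finset.range s, (1 : K)) < 1 := by
    refine Valuation.map_sum_sub_sum_lt one_pos _ _ _ fun i _ => ?_
    have := Valuation.map_pow_sub_pow_lt (v := v) (δ := 1) one_pos hw1 (y := 1) (by simp)
      (by rwa [Valuation.map_sub_swap]) i
    simpa using this
  have h2 : v (∑ i ∈ Finset.range s, w ^ i) = 1 := by
    have h3 : v (s : K) = 1 := h s hs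
    rw [← h3]
    refine Valuation.map_eq_of_sub_lt v ?_
    rw [h3]
    simpa using h1
  rw [← mul_neg_geom_sum, map_mul, h2, mul_one]

namespace ReducesToRootOfUnity

variable {v : Valuation K Γ₀} {Q : K} {M : ℕ}

lemma pos (h : ReducesToRootOfUnity v Q M) : 0 < M := h.odd.pos

lemma ne_zero (h : ReducesToRootOfUnity v Q M) : Q ≠ 0 := fun h0 => by
  simpa [h0] using h.map_eq_one

lemma one_sub_ne_zero (h : ReducesToRootOfUnity v Q M) {t : ℕ} (ht : t ≠ 0) : 1 - Q ^ t ≠ 0 :=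
  sub_ne_zero.2 (h.pow_ne_one t ht).symm

lemma map_one_sub_mul (h : ReducesToRootOfUnity v Q M) {s : ℕ} (hs : s ≠ 0) :
    v (1 - Q ^ (M * s)) = v (1 - Q ^ M) := by
  rw [pow_mul]
  exact Valuation.map_one_sub_pow_of_lt h.map_one_sub_lt h.map_natCast hs

lemma map_one_sub_lt_of_dvd (h : ReducesToRootOfUnity v Q M) {t : ℕ} (ht : M ∣ t) :
    v (1 - Q ^ t) < 1 := by
  obtain ⟨s, rfl⟩ := ht
  rcases eq_or_ne s 0 with rfl | hs
  · simp
  · rw [h.map_one_sub_mul hs]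
    exact h.map_one_sub_lt

lemma map_one_sub_le (h : ReducesToRootOfUnity v Q M) (t : ℕ) : v (1 - Q ^ t) ≤ 1 := by
  by_cases ht : M ∣ t
  · exact (h.map_one_sub_lt_of_dvd ht).le
  · exact (h.map_one_sub_pow t ht).le

lemma map_pow_sub_pow_lt (h : ReducesToRootOfUnity v Q M) {s t : ℕ} (hst : s ≡ t [MOD M]) :
    v (Q ^ s - Q ^ t) < 1 := by
  wlog hle : s ≤ t generalizing s t
  · rw [Valuation.map_sub_swap]
    exact this hst.symm (le_of_not_ge hle)
  have hd := (Nat.modEq_iff_dvd' hle).1 hst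
  have e : Q ^ s - Q ^ t = Q ^ s * (1 - Q ^ (t - s)) := by
    rw [mul_sub, mul_one, ← pow_add, Nat.add_sub_of_le hle]
  rw [e, map_mul, map_pow, h.map_eq_one, one_pow, one_mul]
  exact h.map_one_sub_lt_of_dvd hd

lemma map_one_sub_sub_one_sub_lt (h : ReducesToRootOfUnity v Q M) {s t : ℕ}
    (hst : s ≡ t [MOD M]) : v ((1 - Q ^ s) - (1 - Q ^ t)) < 1 := by
  rw [sub_sub_sub_cancel_left]
  exact h.map_pow_sub_pow_lt hst.symm

lemma map_two (h : ReducesToRootOfUnity v Q M) : v (2 : K) = 1 := by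
  simpa using h.map_natCast 2 two_ne_zero

/-- Oddness of `M` enters here: either `1 + Q ^ t` is congruent to `2`, or it is a quotient of the
units `1 - Q ^ (2 * t)` and `1 - Q ^ t`. -/
lemma map_one_add_pow (h : ReducesToRootOfUnity v Q M) (t : ℕ) : v (1 + Q ^ t) = 1 := by
  by_cases ht : M ∣ t
  · have e : 1 + Q ^ t = 2 - (1 - Q ^ t) := by ring
    rw [e, Valuation.map_sub_eq_of_lt_left v, h.map_two]
    rw [h.map_two]
    exact h.map_one_sub_lt_of_dvd ht
  · have h2 : ¬ M ∣ t * 2 := fun h2 => ht ((Nat.Coprime.dvd_mul_right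
      (Nat.coprime_comm.1 (Nat.coprime_two_left.2 h.odd))).1 h2)
    have e : (1 - Q ^ t) * (1 + Q ^ t) = 1 - Q ^ (t * 2) := by ring
    have := congrArg v e
    rwa [map_mul, h.map_one_sub_pow t ht, h.map_one_sub_pow _ h2, one_mul] at this

lemma map_one_add (h : ReducesToRootOfUnity v Q M) : v (1 + Q) = 1 := by
  simpa using h.map_one_add_pow 1

lemma coprime_four (h : ReducesToRootOfUnity v Q M) : Nat.Coprime M 4 := by
  have : Nat.Coprime M (2 ^ 2) := (Nat.coprime_comm.1 (Nat.coprime_two_left.2 h.odd)).pow_right 2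
  exact this

/-- The product of a full period of factors `1 - Q ^ (c + 4 * i)` with the non-unit one removed. -/
lemma prod_erase_principalEquiv (h : ReducesToRootOfUnity v Q M) {c i₀ : ℕ} (hi₀ : i₀ < M)
    (hc : M ∣ c + 4 * i₀) :
    PrincipalEquiv v (∏ i ∈ (Finset.range M).erase i₀, (1 - Q ^ (c + 4 * i)))
      (∏ t ∈ Finset.Ico 1 M, (1 - Q ^ t)) := by
  have hdvd : ∀ i ∈ (Finset.range M).erase i₀, ¬ M ∣ c + 4 * i := by
    intro i hi hd
    rw [Finset.mem_erase, Finset.mem_range] at hi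
    have h4 : 4 * i ≡ 4 * i₀ [MOD M] :=
      Nat.ModEq.add_left_cancel' c
        (((Nat.modEq_zero_iff_dvd).2 hd).trans ((Nat.modEq_zero_iff_dvd).2 hc).symm)
    exact hi.1 (Nat.ModEq.eq_of_lt_of_lt
      (Nat.ModEq.cancel_left_of_coprime h.coprime_four h4) hi.2 hi₀)
  have hinj : Set.InjOn (fun i => (c + 4 * i) % M) ((Finset.range M).erase i₀ : Finset ℕ) := by
    intro i hi j hj hij
    rw [Finset.mem_coe, Finset.mem_erase, Finset.mem_range] at hi hj
    exact Nat.ModEq.eq_of_lt_of_lt (Nat.ModEq.cancel_left_of_coprime h.coprime_four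
      (Nat.ModEq.add_left_cancel' c hij)) hi.2 hj.2
  -- Since `M` is prime to `4`, the exponents run once through the nonzero residues.
  have himg : ((Finset.range M).erase i₀).image (fun i => (c + 4 * i) % M) = Finset.Ico 1 M := by
    refine Finset.eq_of_subset_of_card_le ?_ ?_
    · intro t ht
      obtain ⟨i, hi, rfl⟩ := Finset.mem_image.1 ht
      have h1 := hdvd i hi
      rw [Nat.dvd_iff_mod_eq_zero] at h1
      exact Finset.mem_Ico.2 ⟨Nat.one_le_iff_ne_zero.2 h1, Nat.mod_lt _ h.pos⟩
    · rw [Finset.card_image_of_injOn hinj, Finset.card_erase_of_mem (Finset.mem_range.2 hi₀)]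
      simp
  rw [← himg, Finset.prod_image hinj]
  refine PrincipalEquiv.prod _ _ _ fun i hi => ?_
  have h1 : ¬ M ∣ (c + 4 * i) % M := fun hd => hdvd i hi ((Nat.dvd_mod_iff dvd_rfl).1 hd)
  rw [PrincipalEquiv, h.map_one_sub_pow _ h1]
  exact h.map_one_sub_sub_one_sub_lt (Nat.mod_modEq _ _).symm

/-- A `q`-analogue of Lucas' theorem for shifted factorials over full periods. -/
lemma qShifted_mul_principalEquiv (h : ReducesToRootOfUnity v Q M) {c i₀ c' : ℕ} (hi₀ : i₀ < M)
    (hc : c + 4 * i₀ = M * c') (hc' : c' ≠ 0) (u : ℕ) :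
    PrincipalEquiv v (qShifted (Q ^ c) (Q ^ 4) (u * M))
      ((∏ t ∈ Finset.Ico 1 M, (1 - Q ^ t)) ^ u * qShifted ((Q ^ M) ^ c') ((Q ^ M) ^ 4) u) := by
  induction u with
  | zero => simpa [qShifted_zero] using PrincipalEquiv.refl v one_ne_zero
  | succ u ih =>
    have e : Q ^ c * (Q ^ 4) ^ (u * M) = Q ^ (c + 4 * (u * M)) := by rw [pow_add, pow_mul Q 4]
    -- In every period the non-unit factor sits at the same index `i₀` and is exactly the next
    -- factor of the shifted factorial in `Q ^ M`.
    have hi : c + 4 * (u * M) + 4 * i₀ = M * (c' + 4 * u) := by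
      rw [add_right_comm, hc]; ring
    rw [add_mul, one_mul, qShifted_add, qShifted_succ, pow_succ _ u, e, mul_mul_mul_comm]
    refine ih.mul ?_
    rw [qShifted_pow_pow, ← Finset.prod_erase_mul _ _ (Finset.mem_range.2 hi₀)]
    refine (h.prod_erase_principalEquiv hi₀ (hi ▸ dvd_mul_right _ _)).mul ?_
    have e2 : (Q ^ M) ^ c' * ((Q ^ M) ^ 4) ^ u = Q ^ (M * (c' + 4 * u)) := by
      rw [← pow_mul (Q ^ M) 4, ← pow_add, ← pow_mul]
    rw [hi, e2]
    exact PrincipalEquiv.refl v (h.one_sub_ne_zero (mul_ne_zero h.pos.ne' (by omega)))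

end ReducesToRootOfUnity

end RootOfUnityAt

section Summands

variable {F : Type*} [Field F]

/-- The ratio `(Q²; Q⁴)_k / (Q⁴; Q⁴)_k`. -/
def shiftedRatio (Q : F) (k : ℕ) : F :=
  qShifted (Q ^ 2) (Q ^ 4) k / qShifted (Q ^ 4) (Q ^ 4) k

/-- The summand of the truncated very-well-poised series with three equal parameters. -/
def cubicSummand (Q : F) (k : ℕ) : F :=
  ((1 + Q ^ (4 * k + 1)) * qShifted (Q ^ 2) (Q ^ 4) k ^ 3)
    / ((1 + Q) * qShifted (Q ^ 4) (Q ^ 4) k ^ 3) * Q ^ k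

/-- The deformation of `cubicSummand` in which two of the parameters are multiplied by `w` and
`w⁻¹`. -/
def deformedSummand (Q w : F) (k : ℕ) : F :=
  ((1 + Q ^ (4 * k + 1)) * (qShifted (Q ^ 2) (Q ^ 4) k *
      ∏ i ∈ Finset.range k, ((1 - Q ^ (2 + 4 * i) * w) * (1 - Q ^ (2 + 4 * i) * w⁻¹))))
    / ((1 + Q) * (qShifted (Q ^ 4) (Q ^ 4) k *
      ∏ i ∈ Finset.range k, ((1 - Q ^ (4 + 4 * i) * w) * (1 - Q ^ (4 + 4 * i) * w⁻¹)))) * Q ^ k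

/-- The ratio `(Q³; Q⁴) / (Q⁵; Q⁴)` of shifted factorials of length `(N - 1) / 2`. -/
def gammaRatio (N : ℕ) (Q : F) : F :=
  qShifted (Q ^ 3) (Q ^ 4) ((N - 1) / 2) / qShifted (Q ^ 5) (Q ^ 4) ((N - 1) / 2)

/-- The closed form of the deformed series. -/
def closedForm (N : ℕ) (Q : F) : F :=
  qInteger N (Q ^ 2) * gammaRatio N Q * Q ^ ((1 - (N : ℤ)) / 2)

lemma cubicSummand_eq (Q : F) (k : ℕ) :
    cubicSummand Q k = (1 + Q ^ (4 * k + 1)) / (1 + Q) * shiftedRatio Q k ^ 3 * Q ^ k := by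
  rw [cubicSummand, shiftedRatio, div_pow, div_mul_div_comm]

end Summands

/-! ### Summands: Lucas congruences to first order, deformation to second order. -/

namespace ReducesToRootOfUnity

variable {K Γ₀ : Type*} [Field K] [LinearOrderedCommGroupWithZero Γ₀] {v : Valuation K Γ₀} {Q : K}
  {M : ℕ}

lemma not_dvd_four_mul (h : ReducesToRootOfUnity v Q M) {i : ℕ} (hi : i + 1 < M) :
    ¬ M ∣ 4 + 4 * i := fun hd => by
  have e : 4 + 4 * i = 4 * (i + 1) := by ring
  rw [e, h.coprime_four.dvd_mul_left] at hd
  exact absurd (Nat.le_of_dvd (Nat.succ_pos i) hd) (not_le.2 hi)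

lemma map_qShifted_four (h : ReducesToRootOfUnity v Q M) {k : ℕ} (hk : k < M) :
    v (qShifted (Q ^ 4) (Q ^ 4) k) = 1 := by
  rw [qShifted_pow_pow]
  refine Valuation.map_prod_eq_one _ _ fun i hi => h.map_one_sub_pow _ (h.not_dvd_four_mul ?_)
  have := Finset.mem_range.1 hi
  omega

lemma map_qShifted_le (h : ReducesToRootOfUnity v Q M) (c e k : ℕ) :
    v (qShifted (Q ^ c) (Q ^ e) k) ≤ 1 := by
  rw [qShifted_pow_pow]
  exact Valuation.map_prod_le_one _ _ fun i _ => h.map_one_sub_le _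

lemma map_shiftedRatio_le (h : ReducesToRootOfUnity v Q M) {k : ℕ} (hk : k < M) :
    v (shiftedRatio Q k) ≤ 1 := by
  rw [shiftedRatio, map_div₀, h.map_qShifted_four hk, div_one]
  exact h.map_qShifted_le _ _ _

/-- The analogue of Lucas' congruence for `shiftedRatio`, over full periods. -/
lemma shiftedRatio_mul_principalEquiv (h : ReducesToRootOfUnity v Q M) (u : ℕ) :
    PrincipalEquiv v (shiftedRatio Q (u * M)) (shiftedRatio (Q ^ M) u) := by
  have hM := h.odd
  obtain ⟨m, hm⟩ := hM
  -- The indices come from `2 + 4 * m = 2 * M` and `4 + 4 * (M - 1) = 4 * M`. The unit parts of the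
  -- two periods agree and cancel.
  have h2 := h.qShifted_mul_principalEquiv (c := 2) (i₀ := m) (c' := 2) (by omega) (by omega)
    (by omega) u
  have h4 := h.qShifted_mul_principalEquiv (c := 4) (i₀ := M - 1) (c' := 4) (by omega) (by omega)
    (by omega) u
  have hE : (∏ t ∈ Finset.Ico 1 M, (1 - Q ^ t)) ^ u ≠ 0 :=
    pow_ne_zero _ (Finset.prod_ne_zero_iff.2 fun t ht =>
      h.one_sub_ne_zero (Nat.one_le_iff_ne_zero.1 (Finset.mem_Ico.1 ht).1))
  have := h2.div h4
  rwa [mul_div_mul_left _ _ hE] at this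

/-- Numerator and denominator have equally many factors, each with the valuation of `1 - Q ^ M`. -/
lemma map_shiftedRatio_pow (h : ReducesToRootOfUnity v Q M) (u : ℕ) :
    v (shiftedRatio (Q ^ M) u) = 1 := by
  have hpos : 0 < v (1 - Q ^ M) := (Valuation.pos_iff v).2 (h.one_sub_ne_zero h.pos.ne')
  have key : ∀ c : ℕ, c ≠ 0 → v (qShifted ((Q ^ M) ^ c) ((Q ^ M) ^ 4) u) = v (1 - Q ^ M) ^ u := by
    intro c hc
    rw [qShifted_pow_pow, map_prod, Finset.prod_congr rfl fun i _ => ?_, Finset.prod_const,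
      Finset.card_range]
    exact Valuation.map_one_sub_pow_of_lt h.map_one_sub_lt h.map_natCast (by omega)
  rw [shiftedRatio, map_div₀, key 2 two_ne_zero, key 4 four_ne_zero,
    div_self (pow_ne_zero _ hpos.ne')]

/-- After `u` full periods the remaining `k` factors have exponents shifted by a multiple of `M`, so
they are congruent to the initial ones; for `k < M` the denominators among them are units. -/
lemma map_shiftedRatio_sub_lt (h : ReducesToRootOfUnity v Q M) (u : ℕ) {k : ℕ} (hk : k < M) :
    v (shiftedRatio Q (u * M + k) - shiftedRatio Q k * shiftedRatio (Q ^ M) u) < 1 := by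
  have e : ∀ c : ℕ, qShifted (Q ^ c) (Q ^ 4) (u * M + k)
      = qShifted (Q ^ c) (Q ^ 4) (u * M) * qShifted (Q ^ (c + 4 * (u * M))) (Q ^ 4) k := by
    intro c
    rw [qShifted_add, pow_add, pow_mul Q 4]
  have hmod : ∀ c i : ℕ, c + 4 * (u * M) + 4 * i ≡ c + 4 * i [MOD M] := by
    intro c i
    have e1 : c + 4 * (u * M) + 4 * i = c + 4 * i + (4 * u) * M := by ring
    rw [e1]
    exact Nat.add_mul_modulus_modEq_iff.2 rfl
  have hd : v (qShifted (Q ^ (4 + 4 * (u * M))) (Q ^ 4) k) = 1 := by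
    rw [qShifted_pow_pow]
    refine Valuation.map_prod_eq_one _ _ fun i hi => h.map_one_sub_pow _ fun hd => ?_
    have := Finset.mem_range.1 hi
    exact h.not_dvd_four_mul (i := i) (by omega) (((hmod 4 i).dvd_iff dvd_rfl).1 hd)
  have hs : ∀ c : ℕ, v (qShifted (Q ^ (c + 4 * (u * M))) (Q ^ 4) k
      - qShifted (Q ^ c) (Q ^ 4) k) < 1 := by
    intro c
    rw [qShifted_pow_pow, qShifted_pow_pow]
    exact Valuation.map_prod_sub_prod_lt one_pos _ _ _ (fun i _ => h.map_one_sub_le _)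
      (fun i _ => h.map_one_sub_le _) fun i _ => h.map_one_sub_sub_one_sub_lt (hmod c i)
  have hr := Valuation.map_div_sub_div_lt (h.map_qShifted_le 2 4 k) hd (h.map_qShifted_four hk)
    (hs 2) (hs 4)
  have hu := (h.shiftedRatio_mul_principalEquiv u).map_sub_lt_one (h.map_shiftedRatio_pow u).le
  have hu' := (h.shiftedRatio_mul_principalEquiv u).map_eq.trans (h.map_shiftedRatio_pow u)
  have := Valuation.map_mul_sub_mul_lt hu'.le (h.map_shiftedRatio_le hk) hr hu
  convert this using 3
  rw [shiftedRatio, e 2, e 4, shiftedRatio, div_mul_div_comm, mul_comm, mul_comm (qShifted (Q ^ (4 + _)) _ k)]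

lemma map_cubicSummand_sub_lt (h : ReducesToRootOfUnity v Q M) (u : ℕ) {k : ℕ} (hk : k < M) :
    v (cubicSummand Q (u * M + k) - cubicSummand Q k * shiftedRatio (Q ^ M) u ^ 3) < 1 := by
  have hT := h.map_shiftedRatio_le hk
  have hW := h.map_shiftedRatio_pow u
  have hTW : v (shiftedRatio Q k * shiftedRatio (Q ^ M) u) ≤ 1 := by
    rw [map_mul, hW, mul_one]; exact hT
  have h1 := h.map_shiftedRatio_sub_lt u hk
  have hT' : v (shiftedRatio Q (u * M + k)) ≤ 1 := by
    have := Valuation.map_add_le v h1.le hTW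
    rwa [sub_add_cancel] at this
  have h3 := Valuation.map_pow_sub_pow_lt one_pos hT' hTW h1 3
  have hp : ∀ s t : ℕ, s ≡ t [MOD M] → v (Q ^ s - Q ^ t) < 1 := fun s t => h.map_pow_sub_pow_lt
  have hm1 : u * M + k ≡ k [MOD M] := by
    rw [add_comm]; exact Nat.add_mul_modulus_modEq_iff.2 rfl
  have hm2 : 4 * (u * M + k) + 1 ≡ 4 * k + 1 [MOD M] := (hm1.mul_left 4).add_right 1
  have hf : v ((1 + Q ^ (4 * (u * M + k) + 1)) / (1 + Q) - (1 + Q ^ (4 * k + 1)) / (1 + Q)) < 1 := by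
    rw [← sub_div, map_div₀, h.map_one_add, div_one, add_sub_add_left_eq_sub]
    exact hp _ _ hm2
  have hfv : v ((1 + Q ^ (4 * k + 1)) / (1 + Q)) ≤ 1 := by
    rw [map_div₀, h.map_one_add, h.map_one_add_pow, div_one]
  have h4 := Valuation.map_mul_sub_mul_lt (by rw [map_pow]; exact pow_le_one₀ zero_le hT') hfv hf h3
  have h5 := Valuation.map_mul_sub_mul_lt (x' := Q ^ (u * M + k))
    (by rw [map_pow, h.map_eq_one, one_pow]) (by
      rw [map_mul]
      exact mul_le_one₀ hfv zero_le (by rw [map_pow]; exact pow_le_one₀ zero_le hTW)) h4 (hp _ _ hm1)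
  convert h5 using 3
  · rw [cubicSummand_eq]
  · rw [cubicSummand_eq]; ring

/-- The deformed series agrees with the original one to second order. -/
lemma map_cubicSummand_sub_deformedSummand_lt (h : ReducesToRootOfUnity v Q M) {δ : Γ₀}
    (hδ : v (1 - Q ^ M) ^ 2 < δ) {k : ℕ} (hk : k < M) :
    v (cubicSummand Q k - deformedSummand Q (Q ^ (2 * M)) k) < δ := by
  set w := Q ^ (2 * M) with hw
  have hδ0 : 0 < δ := lt_of_le_of_lt zero_le hδ
  have hvw : v w = 1 := by rw [hw, map_pow, h.map_eq_one, one_pow]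
  have hw0 : w ≠ 0 := pow_ne_zero _ h.ne_zero
  have hε : v (1 - w) = v (1 - Q ^ M) := by
    rw [hw, mul_comm 2 M]; exact h.map_one_sub_mul two_ne_zero
  -- The first-order terms from `w` and `w⁻¹` cancel; the difference is `Q ^ s * (1 - w) ^ 2 / w`.
  have hfac : ∀ s : ℕ, v ((1 - Q ^ s) ^ 2 - (1 - Q ^ s * w) * (1 - Q ^ s * w⁻¹)) < δ := by
    intro s
    have e : (1 - Q ^ s) ^ 2 - (1 - Q ^ s * w) * (1 - Q ^ s * w⁻¹)
        = Q ^ s * (1 - w) ^ 2 * w⁻¹ := by field_simp; ring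
    rw [e, map_mul, map_mul, map_inv₀, hvw, map_pow, map_pow, h.map_eq_one, hε]
    simpa using hδ
  have hmulw : ∀ s : ℕ, v (1 - Q ^ s * w) ≤ 1 ∧ v (1 - Q ^ s * w⁻¹) ≤ 1 := by
    intro s
    constructor <;> refine Valuation.map_sub_le v (by simp) ?_ <;>
      simp [h.map_eq_one, hvw]
  have hle : ∀ s : ℕ, v ((1 - Q ^ s * w) * (1 - Q ^ s * w⁻¹)) ≤ 1 := fun s => by
    rw [map_mul]; exact mul_le_one₀ (hmulw s).1 zero_le (hmulw s).2
  have hsq : ∀ s : ℕ, v ((1 - Q ^ s) ^ 2) ≤ 1 := fun s => by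
    rw [map_pow]; exact pow_le_one₀ zero_le (h.map_one_sub_le s)
  have hunit : ∀ s : ℕ, ¬ M ∣ s → v ((1 - Q ^ s * w) * (1 - Q ^ s * w⁻¹)) = 1 := by
    intro s hs
    have h1 : v (1 - Q ^ s * w) = 1 := by
      rw [hw, ← pow_add]
      exact h.map_one_sub_pow _ fun hd => hs ((Nat.dvd_add_left (dvd_mul_left M 2)).1 hd)
    have h2 : v (1 - Q ^ s * w⁻¹) = 1 := by
      have h3 : v (1 - Q ^ s * w⁻¹ - (1 - Q ^ s)) < 1 := by
        have e : 1 - Q ^ s * w⁻¹ - (1 - Q ^ s) = -(Q ^ s * w⁻¹ * (1 - w)) := by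
          field_simp; ring
        rw [e, Valuation.map_neg, map_mul, map_mul, map_inv₀, hvw, map_pow, h.map_eq_one, hε]
        simpa using h.map_one_sub_lt
      rw [← h.map_one_sub_pow s hs] at h3 ⊢
      exact Valuation.map_eq_of_sub_lt v h3
    rw [map_mul, h1, h2, one_mul]
  have hprod : ∀ c : ℕ, v (qShifted (Q ^ c) (Q ^ 4) k ^ 2 - ∏ i ∈ Finset.range k,
      ((1 - Q ^ (c + 4 * i) * w) * (1 - Q ^ (c + 4 * i) * w⁻¹))) < δ := by
    intro c
    rw [qShifted_pow_pow, ← Finset.prod_pow]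
    exact Valuation.map_prod_sub_prod_lt hδ0 _ _ _ (fun i _ => hsq _) (fun i _ => hle _)
      fun i _ => hfac _
  have hnum : v (∏ i ∈ Finset.range k,
      ((1 - Q ^ (2 + 4 * i) * w) * (1 - Q ^ (2 + 4 * i) * w⁻¹))) ≤ 1 :=
    Valuation.map_prod_le_one _ _ fun i _ => hle _
  have hden : v (∏ i ∈ Finset.range k,
      ((1 - Q ^ (4 + 4 * i) * w) * (1 - Q ^ (4 + 4 * i) * w⁻¹))) = 1 := by
    refine Valuation.map_prod_eq_one _ _ fun i hi => hunit _ (h.not_dvd_four_mul ?_)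
    have := Finset.mem_range.1 hi
    omega
  have hd4 := h.map_qShifted_four hk
  have hq := Valuation.map_div_sub_div_lt hnum (by rw [map_pow, hd4, one_pow]) hden
    (hprod 2) (hprod 4)
  have e : cubicSummand Q k - deformedSummand Q w k
      = (1 + Q ^ (4 * k + 1)) / (1 + Q) * shiftedRatio Q k * Q ^ k *
        (qShifted (Q ^ 2) (Q ^ 4) k ^ 2 / qShifted (Q ^ 4) (Q ^ 4) k ^ 2
          - (∏ i ∈ Finset.range k, ((1 - Q ^ (2 + 4 * i) * w) * (1 - Q ^ (2 + 4 * i) * w⁻¹)))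
          / ∏ i ∈ Finset.range k, ((1 - Q ^ (4 + 4 * i) * w) * (1 - Q ^ (4 + 4 * i) * w⁻¹))) := by
    rw [cubicSummand, deformedSummand, shiftedRatio, mul_sub]
    congr 1
    · rw [← div_mul_div_comm, pow_succ (qShifted (Q ^ 2) _ k) 2, pow_succ (qShifted (Q ^ 4) _ k) 2,
        ← div_mul_div_comm]
      ring
    · rw [← div_mul_div_comm, ← div_mul_div_comm]; ring
  rw [e, map_mul]
  refine lt_of_le_of_lt (mul_le_of_le_one_left' ?_) hq
  rw [map_mul, map_mul, map_div₀, h.map_one_add, h.map_one_add_pow, map_pow, h.map_eq_one]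
  simpa using h.map_shiftedRatio_le hk

end ReducesToRootOfUnity

/-! ### Evaluation of the deformed series. -/

section ClosedForm

variable {F : Type*} [Field F] {Q : F}

/-- The factor with `i = m` is `1 - w * w⁻¹`. This is why both truncations, `d = 1` and `d = 2`,
give the same sum. -/
lemma deformedSummand_eq_zero (hQ : Q ≠ 0) {m k : ℕ} (hk : m < k) :
    deformedSummand Q (Q ^ (2 * (2 * m + 1))) k = 0 := by
  have h0 : ∏ i ∈ Finset.range k, ((1 - Q ^ (2 + 4 * i) * Q ^ (2 * (2 * m + 1)))
      * (1 - Q ^ (2 + 4 * i) * (Q ^ (2 * (2 * m + 1)))⁻¹)) = 0 := by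
    refine Finset.prod_eq_zero (Finset.mem_range.2 hk) ?_
    have e : 2 + 4 * m = 2 * (2 * m + 1) := by ring
    rw [e, mul_inv_cancel₀ (pow_ne_zero _ hQ), sub_self, mul_zero]
  rw [deformedSummand, h0, mul_zero, mul_zero, zero_div, zero_mul]

lemma qShifted_mul_comm_shift (Q : F) (k : ℕ) :
    (1 - Q) * qShifted (Q ^ 5) (Q ^ 4) k = qShifted Q (Q ^ 4) k * (1 - Q ^ (4 * k + 1)) := by
  have e : Q ^ 5 = Q * Q ^ 4 := by ring
  rw [e, ← qShifted_succ', qShifted_succ, ← pow_mul, pow_succ Q (4 * k), mul_comm Q (Q ^ (4 * k))]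

/-- In base `Q ^ 4`, the parameters `a`, `c`, `x⁻¹` are `Q ^ 2`, `Q ^ 2 * w`, `Q ^ 2 * w⁻¹`. The
choice `b = Q` makes the argument equal to `Q` and turns the very-well-poised factor `1 - Q ^ (8 * k
+ 2)` into `1 + Q ^ (4 * k + 1)`, up to a constant. -/
lemma sixPhiFiveTerm_eq_deformedSummand (hQ : Q ≠ 0) (hQ' : ∀ t, t ≠ 0 → Q ^ t ≠ 1) (m k : ℕ) :
    sixPhiFiveTerm (Q ^ 2) Q (Q ^ 2 * Q ^ (2 * (2 * m + 1))) (Q ^ 4) ((Q ^ 4) ^ m) k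
      = (1 - Q ^ 2) * deformedSummand Q (Q ^ (2 * (2 * m + 1))) k := by
  set w := Q ^ (2 * (2 * m + 1)) with hw
  have hw0 : w ≠ 0 := pow_ne_zero _ hQ
  have hx : (Q ^ 4) ^ m = w / Q ^ 2 := by rw [hw]; field_simp; ring
  have e1 : ((Q ^ 4) ^ m)⁻¹ = Q ^ 2 * w⁻¹ := by rw [hx]; field_simp
  have e2 : Q ^ 2 * Q ^ 4 / Q = Q ^ 5 := by field_simp
  have e3 : Q ^ 2 * Q ^ 4 / (Q ^ 2 * w) = Q ^ 4 * w⁻¹ := by field_simp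
  have e4 : Q ^ 2 * Q ^ 4 * (Q ^ 4) ^ m = Q ^ 4 * w := by rw [hx]; field_simp
  have e5 : Q ^ 4 * w / (Q * (Q ^ 2 * w)) = Q := by field_simp
  have hsplit : ∀ c : ℕ, ∏ i ∈ Finset.range k,
      ((1 - Q ^ (c + 4 * i) * w) * (1 - Q ^ (c + 4 * i) * w⁻¹))
      = qShifted (Q ^ c * w) (Q ^ 4) k * qShifted (Q ^ c * w⁻¹) (Q ^ 4) k := by
    intro c
    rw [Finset.prod_mul_distrib]
    congr 1 <;> refine Finset.prod_congr rfl fun i _ => ?_ <;> rw [← pow_mul, pow_add] <;> ring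
  have h1 : 1 - Q ≠ 0 := sub_ne_zero.2 fun h => hQ' 1 one_ne_zero (by rw [pow_one, ← h])
  have h2 : 1 + Q ≠ 0 := fun h => hQ' 2 two_ne_zero (by linear_combination (Q - 1) * h)
  have h3 : 1 - Q ^ (4 * k + 1) ≠ 0 := sub_ne_zero.2 (hQ' _ (by omega)).symm
  have h5 : qShifted (Q ^ 5) (Q ^ 4) k ≠ 0 := qShifted_ne_zero fun i _ => by
    rw [← pow_mul, ← pow_add]; exact hQ' _ (by omega)
  have h6 := qShifted_mul_comm_shift Q k
  have h7 : qShifted Q (Q ^ 4) k / qShifted (Q ^ 5) (Q ^ 4) k = (1 - Q) / (1 - Q ^ (4 * k + 1)) := by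
    rw [div_eq_div_iff h5 h3, h6]
  have e6 : 1 - Q ^ 2 * (Q ^ 4) ^ (2 * k) = (1 - Q ^ (4 * k + 1)) * (1 + Q ^ (4 * k + 1)) := by
    ring
  have e7 : (1 - Q ^ 2 : F) = (1 - Q) * (1 + Q) := by ring
  rw [sixPhiFiveTerm, deformedSummand, e1, e2, e3, e4, e5, hsplit, hsplit, e6, e7]
  calc _ = (1 - Q ^ (4 * k + 1)) * (qShifted Q (Q ^ 4) k / qShifted (Q ^ 5) (Q ^ 4) k) *
        (1 + Q ^ (4 * k + 1)) * ((qShifted (Q ^ 2) (Q ^ 4) k * (qShifted (Q ^ 2 * w) (Q ^ 4) k *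
          qShifted (Q ^ 2 * w⁻¹) (Q ^ 4) k)) / (qShifted (Q ^ 4) (Q ^ 4) k *
          (qShifted (Q ^ 4 * w) (Q ^ 4) k * qShifted (Q ^ 4 * w⁻¹) (Q ^ 4) k))) * Q ^ k := by
        simp only [div_eq_mul_inv, mul_inv]; ring
    _ = _ := by
        rw [h7]
        simp only [div_eq_mul_inv, mul_inv]
        have h8 : (1 - Q ^ (4 * k + 1)) * (1 - Q ^ (4 * k + 1))⁻¹ = 1 := mul_inv_cancel₀ h3
        have h9 : (1 + Q) * (1 + Q)⁻¹ = 1 := mul_inv_cancel₀ h2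
        generalize (1 - Q ^ (4 * k + 1))⁻¹ = y at *
        generalize (1 + Q)⁻¹ = z at *
        generalize 1 - Q ^ (4 * k + 1) = y' at *
        generalize 1 + Q = z' at *
        generalize 1 + Q ^ (4 * k + 1) = z'' at *
        generalize (qShifted (Q ^ 4) (Q ^ 4) k)⁻¹ = a1
        generalize (qShifted (Q ^ 4 * w) (Q ^ 4) k)⁻¹ = a2
        generalize (qShifted (Q ^ 4 * w⁻¹) (Q ^ 4) k)⁻¹ = a3
        have h10 : y' * y = z' * z := by rw [h8, h9]
        linear_combination (1 - Q) * z'' * qShifted (Q ^ 2) (Q ^ 4) k * qShifted (Q ^ 2 * w) (Q ^ 4) k *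
          qShifted (Q ^ 2 * w⁻¹) (Q ^ 4) k * a1 * a2 * a3 * Q ^ k * h10

/-- Reverse the product: `c + c' = 6` makes the exponents at `i` and `m - 1 - i` add up to `4 * m +
2`, the exponent of `w`. -/
lemma qShifted_reflect (hQ : Q ≠ 0) {c c' : ℕ} (hc : c + c' = 6) (m : ℕ) :
    qShifted (Q ^ c' * (Q ^ (2 * (2 * m + 1)))⁻¹) (Q ^ 4) m
        * ∏ i ∈ Finset.range m, Q ^ (c + 4 * i)
      = (-1) ^ m * qShifted (Q ^ c) (Q ^ 4) m := by
  rw [qShifted_pow_pow, qShifted, ← Finset.prod_range_reflect, ← Finset.prod_mul_distrib]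
  have hsgn : (-1 : F) ^ m = ∏ _i ∈ Finset.range m, (-1 : F) := by simp
  rw [hsgn, ← Finset.prod_mul_distrib]
  refine Finset.prod_congr rfl fun i hi => ?_
  have hi := Finset.mem_range.1 hi
  have hw0 : Q ^ (2 * (2 * m + 1)) ≠ 0 := pow_ne_zero _ hQ
  have e : Q ^ c' * (Q ^ 4) ^ (m - 1 - i) * Q ^ (c + 4 * i) = Q ^ (2 * (2 * m + 1)) := by
    rw [← pow_mul, ← pow_add, ← pow_add]
    congr 1
    omega
  generalize Q ^ (2 * (2 * m + 1)) = w at *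
  have e' : Q ^ c' * w⁻¹ * (Q ^ 4) ^ (m - 1 - i) * Q ^ (c + 4 * i) = 1 := by
    rw [mul_right_comm (Q ^ c'), mul_right_comm _ w⁻¹, e, mul_inv_cancel₀ hw0]
  linear_combination -e'

theorem sum_deformedSummand (hQ : Q ≠ 0) (hQ' : ∀ t, t ≠ 0 → Q ^ t ≠ 1) {M : ℕ} (hM : Odd M)
    {d : ℕ} (hd : d = 1 ∨ d = 2) :
    ∑ k ∈ Finset.range ((M - 1) / d + 1), deformedSummand Q (Q ^ (2 * M)) k = closedForm M Q := by
  obtain ⟨m, rfl⟩ := hM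
  have hm2 : (2 * m + 1 - 1) / 2 = m := by omega
  have hsub : ∑ k ∈ Finset.range (m + 1), deformedSummand Q (Q ^ (2 * (2 * m + 1))) k
      = ∑ k ∈ Finset.range ((2 * m + 1 - 1) / d + 1),
          deformedSummand Q (Q ^ (2 * (2 * m + 1))) k := by
    refine Finset.sum_subset (Finset.range_mono ?_) fun k _ hk => ?_
    · rcases hd with rfl | rfl <;> omega
    · rw [Finset.mem_range, not_lt] at hk
      exact deformedSummand_eq_zero hQ (by omega)
  have hinj : ∀ {s t : ℕ}, Q ^ s = Q ^ t → s = t := by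
    intro s t hst
    wlog hle : s ≤ t generalizing s t
    · exact (this hst.symm (le_of_not_ge hle)).symm
    by_contra hne
    refine hQ' (t - s) (by omega) (mul_left_cancel₀ (pow_ne_zero s hQ) ?_)
    rw [← pow_add, Nat.add_sub_of_le hle, mul_one, hst]
  have hne2 : (1 - Q ^ 2 : F) ≠ 0 := sub_ne_zero.2 (hQ' 2 two_ne_zero).symm
  set w := Q ^ (2 * (2 * m + 1)) with hw
  have hw0 : w ≠ 0 := pow_ne_zero _ hQ
  have e2 : Q ^ 2 * Q ^ 4 / Q = Q ^ 5 := by field_simp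
  have e3 : Q ^ 2 * Q ^ 4 / (Q ^ 2 * w) = Q ^ 4 * w⁻¹ := by field_simp
  have e6 : Q ^ 2 * Q ^ 4 / (Q * (Q ^ 2 * w)) = Q ^ 3 * w⁻¹ := by field_simp
  have h4 : ∀ i, Q ^ 4 * w⁻¹ * (Q ^ 4) ^ i ≠ 1 := by
    intro i hi
    have : Q ^ (4 + 4 * i) = Q ^ (2 * (2 * m + 1)) := by
      rw [← hw, pow_add, pow_mul Q 4]
      field_simp at hi
      exact hi
    have := hinj this
    omega
  have h5 : ∀ i, Q ^ 5 * (Q ^ 4) ^ i ≠ 1 := fun i => by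
    rw [← pow_mul, ← pow_add]; exact hQ' _ (by omega)
  have key := sum_sixPhiFiveTerm (a := Q ^ 2) (b := Q) (c := Q ^ 2 * w) (q := Q ^ 4) hQ
    (mul_ne_zero (pow_ne_zero _ hQ) hw0) (pow_ne_zero _ hQ)
    (fun i => by rw [← pow_mul, ← pow_add]; exact hQ' _ (by omega))
    (by rw [e2]; exact h5) (by rw [e3]; exact h4)
    (fun i => by rw [← pow_mul, ← pow_add, ← pow_add]; exact hQ' _ (by omega)) m
  rw [Finset.sum_congr rfl fun k _ => sixPhiFiveTerm_eq_deformedSummand hQ hQ' m k,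
    ← Finset.mul_sum, mul_div_assoc] at key
  rw [← hsub, mul_left_cancel₀ hne2 key, e2, e3, e6]
  have r3 := qShifted_reflect hQ (show 3 + 3 = 6 by rfl) m
  have r4 := qShifted_reflect hQ (show 2 + 4 = 6 by rfl) m
  rw [← hw] at r3 r4
  -- The two reflections leave monomials whose ratio `Q ^ m` is the source of the power `Q ^ ((1 -
  -- M) / 2)`.
  have hP : ∏ i ∈ Finset.range m, Q ^ (3 + 4 * i) = Q ^ m * ∏ i ∈ Finset.range m, Q ^ (2 + 4 * i) := by
    conv_lhs => rw [Finset.prod_congr rfl fun i _ => show Q ^ (3 + 4 * i) = Q * Q ^ (2 + 4 * i) by ring]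
    rw [Finset.prod_mul_distrib, Finset.prod_const, Finset.card_range]
  rw [hP] at r3
  have hP0 : ∏ i ∈ Finset.range m, Q ^ (2 + 4 * i) ≠ 0 :=
    Finset.prod_ne_zero_iff.2 fun i _ => pow_ne_zero _ hQ
  have d4 : qShifted (Q ^ 4 * w⁻¹) (Q ^ 4) m ≠ 0 := qShifted_ne_zero fun i _ => h4 i
  have d5 : qShifted (Q ^ 5) (Q ^ 4) m ≠ 0 := qShifted_ne_zero fun i _ => h5 i
  -- The quotient `(1 - w) / (1 - Q ^ 2)` obtained here is the `q`-integer of the closed form.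
  have hs : (1 - Q ^ 2) * qShifted (Q ^ 2 * Q ^ 4) (Q ^ 4) m
      = qShifted (Q ^ 2) (Q ^ 4) m * (1 - w) := by
    rw [← qShifted_succ', qShifted_succ, hw, ← pow_mul, ← pow_add]
    congr 3
    ring
  have hz : Q ^ ((1 - ((2 * m + 1 : ℕ) : ℤ)) / 2) = (Q ^ m)⁻¹ := by
    rw [← zpow_natCast, ← zpow_neg]
    congr 1
    push_cast
    omega
  rw [closedForm, gammaRatio, qInteger, hm2, hz, ← pow_mul, ← hw]
  have hQm : Q ^ m ≠ 0 := pow_ne_zero _ hQ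
  generalize qShifted (Q ^ 4 * w⁻¹) (Q ^ 4) m = D4 at *
  generalize qShifted (Q ^ 3 * w⁻¹) (Q ^ 4) m = D3 at *
  generalize qShifted (Q ^ 5) (Q ^ 4) m = D5 at *
  generalize qShifted (Q ^ 2 * Q ^ 4) (Q ^ 4) m = D6 at *
  generalize qShifted (Q ^ 3) (Q ^ 4) m = E3 at *
  generalize qShifted (Q ^ 2) (Q ^ 4) m = E2 at *
  generalize ∏ i ∈ Finset.range m, Q ^ (2 + 4 * i) = P at *
  generalize 1 - Q ^ 2 = s at *
  generalize Q ^ m = y at *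
  clear_value w
  have hsgn : ((-1 : F) ^ m) ≠ 0 := by simp
  generalize (-1 : F) ^ m = ε at *
  field_simp
  refine mul_left_cancel₀ (mul_ne_zero hsgn hP0) ?_
  linear_combination (ε * D3 * y * P) * hs + E2 * (1 - w) * ε * r3 - (1 - w) * ε * E3 * r4

end ClosedForm

lemma Finset.sum_range_mul_eq {A : Type*} [AddCommMonoid A] (f : ℕ → A) (U M : ℕ) :
    ∑ k ∈ Finset.range (U * M), f k
      = ∑ u ∈ Finset.range U, ∑ k ∈ Finset.range M, f (u * M + k) := by
  induction U with
  | zero => simp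
  | succ U ih => rw [add_mul, one_mul, Finset.sum_range_add, ih, Finset.sum_range_succ]

/-! ### Truncated sums modulo powers of the prime, and valuations of the closed form. -/

namespace ReducesToRootOfUnity

variable {K Γ₀ : Type*} [Field K] [LinearOrderedCommGroupWithZero Γ₀] {v : Valuation K Γ₀} {Q : K}
  {M : ℕ}

lemma map_sum_cubicSummand_sub_closedForm_lt (h : ReducesToRootOfUnity v Q M) {δ : Γ₀}
    (hδ : v (1 - Q ^ M) ^ 2 < δ) {d : ℕ} (hd : d = 1 ∨ d = 2) :
    v (∑ k ∈ Finset.range ((M - 1) / d + 1), cubicSummand Q k - closedForm M Q) < δ := by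
  rw [← sum_deformedSummand h.ne_zero h.pow_ne_one h.odd hd]
  refine Valuation.map_sum_sub_sum_lt (lt_of_le_of_lt zero_le hδ) _ _ _ fun k hk => ?_
  refine h.map_cubicSummand_sub_deformedSummand_lt hδ ?_
  have := h.pos
  have := Finset.mem_range.1 hk
  have : (M - 1) / d ≤ M - 1 := Nat.div_le_self _ _
  omega

lemma map_shiftedRatio_lt (h : ReducesToRootOfUnity v Q M) {k : ℕ} (hk : k < M)
    (hk' : (M - 1) / 2 < k) : v (shiftedRatio Q k) < 1 := by
  obtain ⟨m, hm⟩ := h.odd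
  have hk2 : m ∈ Finset.range k := Finset.mem_range.2 (by omega)
  rw [shiftedRatio, map_div₀, h.map_qShifted_four hk, div_one, qShifted_pow_pow,
    ← Finset.mul_prod_erase _ _ hk2, map_mul]
  refine lt_of_le_of_lt (mul_le_of_le_one_right'
    (Valuation.map_prod_le_one _ _ fun i _ => h.map_one_sub_le _)) ?_
  exact h.map_one_sub_lt_of_dvd ⟨2, by omega⟩

lemma map_cubicSummand_lt (h : ReducesToRootOfUnity v Q M) {k : ℕ} (hk : k < M)
    (hk' : (M - 1) / 2 < k) : v (cubicSummand Q k) < 1 := by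
  rw [cubicSummand_eq, map_mul, map_mul, map_div₀, h.map_one_add, h.map_one_add_pow, map_pow,
    map_pow, h.map_eq_one]
  simpa using pow_lt_one₀ zero_le (h.map_shiftedRatio_lt hk hk') three_ne_zero

lemma map_sum_shiftedRatio_le (h : ReducesToRootOfUnity v Q M) (U : ℕ) :
    v (∑ u ∈ Finset.range U, shiftedRatio (Q ^ M) u ^ 3) ≤ 1 :=
  Valuation.map_sum_le v fun u _ => by rw [map_pow, h.map_shiftedRatio_pow, one_pow]

lemma map_sum_full_periods_sub_lt (h : ReducesToRootOfUnity v Q M) (U : ℕ) :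
    v (∑ k ∈ Finset.range (U * M), cubicSummand Q k
      - (∑ k ∈ Finset.range M, cubicSummand Q k)
        * ∑ u ∈ Finset.range U, shiftedRatio (Q ^ M) u ^ 3) < 1 := by
  rw [Finset.sum_range_mul_eq, Finset.mul_sum]
  refine Valuation.map_sum_sub_sum_lt one_pos _ _ _ fun u _ => ?_
  rw [Finset.sum_mul]
  exact Valuation.map_sum_sub_sum_lt one_pos _ _ _ fun k hk =>
    h.map_cubicSummand_sub_lt u (Finset.mem_range.1 hk)

/-- The truncated series of length `(M * L - 1) / d + 1` factors modulo the maximal ideal. -/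
lemma map_sum_cubicSummand_sub_mul_lt (h : ReducesToRootOfUnity v Q M) {L : ℕ} (hL : Odd L)
    {d : ℕ} (hd : d = 1 ∨ d = 2) :
    v (∑ k ∈ Finset.range ((M * L - 1) / d + 1), cubicSummand Q k
      - closedForm M Q * ∑ u ∈ Finset.range ((L - 1) / d + 1), shiftedRatio (Q ^ M) u ^ 3) < 1 := by
  have hM := h.pos
  obtain ⟨l, rfl⟩ := hL
  set U := (2 * l + 1 - 1) / d + 1 with hU
  have hpos : 0 < M * (2 * l + 1) := Nat.mul_pos hM (by omega)
  have hle : (M * (2 * l + 1) - 1) / d + 1 ≤ U * M := by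
    rcases hd with rfl | rfl
    · have e : U * M = M * (2 * l + 1) := by rw [hU, Nat.div_one]; simp [mul_comm]
      rw [e, Nat.div_one]; omega
    · have e : U = l + 1 := by omega
      have e2 : M * (2 * l + 1) = 2 * (l * M) + M := by ring
      rw [e, e2, add_mul, one_mul]; omega
  have h1 : v (∑ k ∈ Finset.range ((M * (2 * l + 1) - 1) / d + 1), cubicSummand Q k
      - ∑ k ∈ Finset.range (U * M), cubicSummand Q k) < 1 := by
    -- Completing the last period is free: for `d = 1` nothing is missing, and for `d = 2` the
    -- missing terms lie in the second half of a period, where the numerator contains `1 - Q ^ (2 *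
    -- M)`.
    rw [Valuation.map_sub_swap, ← Finset.sum_range_add_sum_Ico _ hle, add_sub_cancel_left]
    refine Valuation.map_sum_lt' v one_pos fun k hk => ?_
    rw [Finset.mem_Ico] at hk
    rcases hd with rfl | rfl
    · exfalso
      have e : U * M = M * (2 * l + 1) := by rw [hU, Nat.div_one]; simp [mul_comm]
      omega
    · obtain ⟨m, hm⟩ := h.odd
      have e : U = l + 1 := by omega
      have e2 : M * (2 * l + 1) = 2 * (l * M) + M := by ring
      rw [e, e2, add_mul, one_mul] at hk
      obtain ⟨j, rfl⟩ : ∃ j, k = l * M + j := Nat.exists_eq_add_of_le (by omega)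
      have hj : j < M := by omega
      have h2 := h.map_cubicSummand_sub_lt l hj
      have h3 : v (cubicSummand Q j * shiftedRatio (Q ^ M) l ^ 3) < 1 := by
        rw [map_mul, map_pow, h.map_shiftedRatio_pow, one_pow, mul_one]
        exact h.map_cubicSummand_lt hj (by omega)
      simpa using Valuation.map_add_lt v h2 h3
  refine Valuation.map_sub_lt_trans h1
    (Valuation.map_sub_lt_trans (h.map_sum_full_periods_sub_lt U) ?_)
  -- A full period is the truncation with divisor `1`, whatever `d` is.
  have h4 := h.map_sum_cubicSummand_sub_closedForm_lt (δ := 1)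
    (pow_lt_one₀ zero_le h.map_one_sub_lt two_ne_zero) (Or.inl rfl : (1 : ℕ) = 1 ∨ 1 = 2)
  rw [Nat.div_one, Nat.sub_add_cancel hM] at h4
  rw [← sub_mul, map_mul]
  exact lt_of_le_of_lt (mul_le_of_le_one_right' (h.map_sum_shiftedRatio_le U)) h4

/-- For `M = 4 * j + 1` the exponents `3 + 4 * i` in range avoid multiples of `M`, while `1 + 4 * i`
meets only `M` itself. The resulting zero of the denominator cancels that of the `q`-integer. -/
lemma map_closedForm (h : ReducesToRootOfUnity v Q M) (hM : M ≡ 1 [MOD 4]) :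
    v (closedForm M Q) = 1 := by
  obtain ⟨j, hj⟩ : ∃ j, M = 4 * j + 1 := ⟨M / 4, by have := hM; unfold Nat.ModEq at this; omega⟩
  have hm : (M - 1) / 2 = 2 * j := by omega
  have h3 : v (qShifted (Q ^ 3) (Q ^ 4) (2 * j)) = 1 := by
    rw [qShifted_pow_pow]
    refine Valuation.map_prod_eq_one _ _ fun i hi => h.map_one_sub_pow _ ?_
    rintro ⟨s, hs⟩
    have hi := Finset.mem_range.1 hi
    have hs3 : s < 2 := by
      by_contra hs2
      have : M * 2 ≤ M * s := Nat.mul_le_mul_left _ (not_lt.1 hs2)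
      omega
    interval_cases s <;> omega
  have h1 : v (qShifted Q (Q ^ 4) (2 * j + 1)) = v (1 - Q ^ M) := by
    have e := qShifted_pow_pow Q 1 4 (2 * j + 1)
    rw [pow_one] at e
    rw [e, map_prod, Finset.prod_eq_single j]
    · rw [hj, add_comm]
    · intro i hi hij
      have hi := Finset.mem_range.1 hi
      refine h.map_one_sub_pow _ ?_
      rintro ⟨s, hs⟩
      have hs3 : s < 2 := by
        by_contra hs2
        have : M * 2 ≤ M * s := Nat.mul_le_mul_left _ (not_lt.1 hs2)
        omega
      interval_cases s <;> omega
    · intro hj'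
      exact absurd (Finset.mem_range.2 (by omega)) hj'
  -- Prepending `1 - Q` covers `M = 1` as well, where `1 - Q` is itself the non-unit.
  have h5 : (1 - Q) * qShifted (Q ^ 5) (Q ^ 4) (2 * j) = qShifted Q (Q ^ 4) (2 * j + 1) := by
    rw [qShifted_mul_comm_shift, qShifted_succ, ← pow_mul, pow_succ Q (4 * _), mul_comm Q (Q ^ _)]
  have h5' := congrArg v h5
  rw [map_mul, h1] at h5'
  have hQ1 : v (1 - Q) ≠ 0 := (Valuation.ne_zero_iff v).2 (by
    simpa using h.one_sub_ne_zero one_ne_zero)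
  have hQM : v (1 - Q ^ M) ≠ 0 := (Valuation.ne_zero_iff v).2 (h.one_sub_ne_zero h.pos.ne')
  have e2 : 1 - Q ^ 2 = (1 - Q) * (1 + Q) := by ring
  have e3 : v (qShifted (Q ^ 5) (Q ^ 4) (2 * j)) = v (1 - Q ^ M) / v (1 - Q) := by
    rw [← h5', mul_div_cancel_left₀ _ hQ1]
  rw [closedForm, gammaRatio, qInteger, hm, map_mul, map_mul, map_zpow₀, h.map_eq_one, one_zpow,
    mul_one, map_div₀, map_div₀, h3, e3, e2, map_mul, h.map_one_add, mul_one, ← pow_mul, mul_comm 2,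
    h.map_one_sub_mul two_ne_zero, one_div, inv_div, div_mul_div_comm, mul_comm (v (1 - Q)),
    div_self (mul_ne_zero hQM hQ1)]

lemma gammaRatio_ne_zero (h : ReducesToRootOfUnity v Q M) (N : ℕ) : gammaRatio N Q ≠ 0 := by
  refine div_ne_zero ?_ ?_ <;> refine qShifted_ne_zero fun i _ => ?_ <;> rw [← pow_mul, ← pow_add] <;>
    exact h.pow_ne_one _ (by omega)

lemma gammaRatio_mul_principalEquiv (h : ReducesToRootOfUnity v Q M) (hM : M ≡ 1 [MOD 4]) {L : ℕ}
    (hL : Odd L) :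
    PrincipalEquiv v (gammaRatio (M * L) Q) (gammaRatio M Q * gammaRatio L (Q ^ M)) := by
  obtain ⟨j, hj⟩ : ∃ j, M = 4 * j + 1 := ⟨M / 4, by have := hM; unfold Nat.ModEq at this; omega⟩
  obtain ⟨l, hl⟩ := hL
  have hN : (M * L - 1) / 2 = 2 * j + l * M := by
    have : M * L = 2 * (l * M) + M := by rw [hl]; ring
    omega
  have hm : (M - 1) / 2 = 2 * j := by omega
  have hl2 : (L - 1) / 2 = l := by omega
  -- After the first `2 * j` factors, `l` full periods remain; the first multiples of `M` met there
  -- are `3 * M` and `5 * M`.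
  have h3 := h.qShifted_mul_principalEquiv (c := 3 + 4 * (2 * j)) (i₀ := j) (c' := 3) (by omega)
    (by omega) (by omega) l
  have h5 := h.qShifted_mul_principalEquiv (c := 5 + 4 * (2 * j)) (i₀ := 3 * j) (c' := 5) (by omega)
    (by omega) (by omega) l
  have hE : (∏ t ∈ Finset.Ico 1 M, (1 - Q ^ t)) ^ l ≠ 0 :=
    pow_ne_zero _ (Finset.prod_ne_zero_iff.2 fun t ht =>
      h.one_sub_ne_zero (Nat.one_le_iff_ne_zero.1 (Finset.mem_Ico.1 ht).1))
  have h35 := h3.div h5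
  rw [mul_div_mul_left _ _ hE] at h35
  have hG := (PrincipalEquiv.refl v (h.gammaRatio_ne_zero M)).mul h35
  have e : ∀ c : ℕ, qShifted (Q ^ c) (Q ^ 4) (2 * j + l * M)
      = qShifted (Q ^ c) (Q ^ 4) (2 * j) * qShifted (Q ^ (c + 4 * (2 * j))) (Q ^ 4) (l * M) := by
    intro c
    rw [qShifted_add, pow_add Q c, pow_mul Q 4]
  have eN : gammaRatio (M * L) Q = gammaRatio M Q *
      (qShifted (Q ^ (3 + 4 * (2 * j))) (Q ^ 4) (l * M)
        / qShifted (Q ^ (5 + 4 * (2 * j))) (Q ^ 4) (l * M)) := by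
    rw [gammaRatio, gammaRatio, hN, hm, e 3, e 5, div_mul_div_comm]
  have eL : gammaRatio L (Q ^ M) = qShifted ((Q ^ M) ^ 3) ((Q ^ M) ^ 4) l
      / qShifted ((Q ^ M) ^ 5) ((Q ^ M) ^ 4) l := by
    rw [gammaRatio, hl2]
  rw [eN, eL]
  exact hG

end ReducesToRootOfUnity

/-! ### The prefactor and the two congruences. -/

section DworkFactor

variable {F : Type*} [Field F]

/-- The factor relating the truncated series at `q` of length `N` and at `q ^ n` of length `N'`. -/
def dworkFactor (n N N' : ℕ) (q : F) : F :=
  qInteger n (q ^ 2) * gammaRatio N q / gammaRatio N' (q ^ n) * q ^ ((1 - (n : ℤ)) / 2)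

/-- The gamma ratios cancel, the `q`-integers multiply, and oddness makes the halved exponents
exact, so they add up. -/
lemma dworkFactor_mul_closedForm {q : F} (hq0 : q ≠ 0) (hq : ∀ t, t ≠ 0 → q ^ t ≠ 1) {n N' : ℕ}
    (hn : Odd n) (hN' : Odd N') (hG : gammaRatio N' (q ^ n) ≠ 0) :
    dworkFactor n (n * N') N' q * closedForm N' (q ^ n) = closedForm (n * N') q := by
  have h1 : (1 - (q ^ 2) ^ n : F) ≠ 0 := by
    rw [← pow_mul]
    exact sub_ne_zero.2 (hq _ (mul_ne_zero two_ne_zero hn.pos.ne')).symm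
  have e1 : (q ^ n) ^ 2 = (q ^ 2) ^ n := by rw [← pow_mul, ← pow_mul, mul_comm]
  have hz : (q ^ n) ^ ((1 - (N' : ℤ)) / 2) * q ^ ((1 - (n : ℤ)) / 2)
      = q ^ ((1 - ((n * N' : ℕ) : ℤ)) / 2) := by
    rw [← zpow_natCast q n, ← zpow_mul, ← zpow_add₀ hq0]
    congr 1
    obtain ⟨a, rfl⟩ := hn
    obtain ⟨b, rfl⟩ := hN'
    have ea : (1 - ((2 * a + 1 : ℕ) : ℤ)) / 2 = -a := by push_cast; omega
    have eb : (1 - ((2 * b + 1 : ℕ) : ℤ)) / 2 = -b := by push_cast; omega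
    have ec : (1 - (((2 * a + 1) * (2 * b + 1) : ℕ) : ℤ)) = 2 * (-(2 * a * b) - a - b) := by
      push_cast; ring
    rw [ea, eb, ec, Int.mul_ediv_cancel_left _ two_ne_zero]
    push_cast
    ring
  rw [dworkFactor, closedForm, closedForm, qInteger, qInteger, qInteger, ← hz, e1, ← pow_mul _ n N']
  generalize q ^ ((1 - (n : ℤ)) / 2) = z
  generalize (q ^ n) ^ ((1 - (N' : ℤ)) / 2) = z'
  generalize 1 - (q ^ 2) ^ n = s at *
  generalize 1 - (q ^ 2) ^ (n * N') = s'
  generalize gammaRatio N' (q ^ n) = G at *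
  field_simp

end DworkFactor

namespace ReducesToRootOfUnity

variable {K Γ₀ : Type*} [Field K] [LinearOrderedCommGroupWithZero Γ₀] {v : Valuation K Γ₀} {q : K}
  {n M N : ℕ}

lemma pow_of_mul (h : ReducesToRootOfUnity v q (n * M)) : ReducesToRootOfUnity v (q ^ n) M where
  odd := (Nat.odd_mul.1 h.odd).2
  map_eq_one := by rw [map_pow, h.map_eq_one, one_pow]
  map_one_sub_pow t ht := by
    rw [← pow_mul]
    exact h.map_one_sub_pow _ fun hd =>
      ht (Nat.dvd_of_mul_dvd_mul_left (Nat.odd_mul.1 h.odd).1.pos hd)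
  map_one_sub_lt := by rw [← pow_mul]; exact h.map_one_sub_lt
  pow_ne_one t ht := by
    rw [← pow_mul]
    exact h.pow_ne_one _ (mul_ne_zero (Nat.odd_mul.1 h.odd).1.pos.ne' ht)
  map_natCast := h.map_natCast

lemma dworkFactor_mul_closedForm (h : ReducesToRootOfUnity v q (n * M)) :
    dworkFactor n (n * M) M q * closedForm M (q ^ n) = closedForm (n * M) q :=
  _root_.dworkFactor_mul_closedForm h.ne_zero h.pow_ne_one (Nat.odd_mul.1 h.odd).1
    (Nat.odd_mul.1 h.odd).2 (h.pow_of_mul.gammaRatio_ne_zero M)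

lemma map_dworkFactor (h : ReducesToRootOfUnity v q (n * M)) (hn : n ≡ 1 [MOD 4])
    (hM : M ≡ 1 [MOD 4]) : v (dworkFactor n (n * M) M q) = 1 := by
  have e := congrArg v h.dworkFactor_mul_closedForm
  rwa [map_mul, h.pow_of_mul.map_closedForm hM, mul_one, h.map_closedForm (hn.mul hM)] at e

/-- The congruence to second order. -/
theorem map_sum_sub_dworkFactor_mul_sum_lt (h : ReducesToRootOfUnity v q (n * M))
    (hn : n ≡ 1 [MOD 4]) (hM : M ≡ 1 [MOD 4]) {d : ℕ} (hd : d = 1 ∨ d = 2) {δ : Γ₀}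
    (hδ : v (1 - q ^ (n * M)) ^ 2 < δ) :
    v (∑ k ∈ Finset.range ((n * M - 1) / d + 1), cubicSummand q k
      - dworkFactor n (n * M) M q
        * ∑ k ∈ Finset.range ((M - 1) / d + 1), cubicSummand (q ^ n) k) < δ := by
  have h1 := h.map_sum_cubicSummand_sub_closedForm_lt hδ hd
  have h2 := h.pow_of_mul.map_sum_cubicSummand_sub_closedForm_lt (δ := δ) (by rwa [← pow_mul]) hd
  refine Valuation.map_sub_lt_trans h1 ?_
  rw [← h.dworkFactor_mul_closedForm, ← mul_sub, map_mul, h.map_dworkFactor hn hM, one_mul,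
    Valuation.map_sub_swap]
  exact h2

/-- Splitting off one period, of length `n * M` in base `q` and `M` in base `q ^ n`, leaves the same
`gammaRatio L (q ^ (n * M))` above and below. -/
lemma dworkFactor_principalEquiv (h : ReducesToRootOfUnity v q (n * M)) (hn : n ≡ 1 [MOD 4])
    (hM : M ≡ 1 [MOD 4]) {L : ℕ} (hL : Odd L) :
    PrincipalEquiv v (dworkFactor n (n * M * L) (M * L) q) (dworkFactor n (n * M) M q) := by
  have h1 := h.gammaRatio_mul_principalEquiv (hn.mul hM) hL
  have h2 := h.pow_of_mul.gammaRatio_mul_principalEquiv hM hL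
  have hz : qInteger n (q ^ 2) * q ^ ((1 - (n : ℤ)) / 2) ≠ 0 := by
    refine mul_ne_zero (div_ne_zero ?_ (h.one_sub_ne_zero two_ne_zero)) (zpow_ne_zero _ h.ne_zero)
    rw [← pow_mul]
    exact h.one_sub_ne_zero (mul_ne_zero two_ne_zero (Nat.odd_mul.1 h.odd).1.pos.ne')
  have h3 := (PrincipalEquiv.refl v hz).mul (h1.div h2)
  rw [← pow_mul] at h3
  have hG : gammaRatio L (q ^ (n * M)) ≠ 0 := right_ne_zero_of_mul
    ((Valuation.pos_iff v).1 h1.pos)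
  rw [mul_div_mul_right _ _ hG] at h3
  have e : ∀ a b z z' : K, a * z / z' * b = a * b * (z / z') := fun a b z z' => by ring
  rw [dworkFactor, dworkFactor, e, e]
  exact h3

/-- The congruence to first order. -/
theorem map_sum_sub_dworkFactor_mul_sum_lt_one (h : ReducesToRootOfUnity v q (n * M))
    (hn : n ≡ 1 [MOD 4]) (hM : M ≡ 1 [MOD 4]) {L : ℕ} (hL : Odd L) {d : ℕ} (hd : d = 1 ∨ d = 2) :
    v (∑ k ∈ Finset.range ((n * M * L - 1) / d + 1), cubicSummand q k
      - dworkFactor n (n * M * L) (M * L) q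
        * ∑ k ∈ Finset.range ((M * L - 1) / d + 1), cubicSummand (q ^ n) k) < 1 := by
  have h1 := h.map_sum_cubicSummand_sub_mul_lt hL hd
  have h2 := h.pow_of_mul.map_sum_cubicSummand_sub_mul_lt hL hd
  rw [← pow_mul] at h2
  have hW := h.map_sum_shiftedRatio_le ((L - 1) / d + 1)
  have h3 := h.dworkFactor_principalEquiv hn hM hL
  have hD := h.map_dworkFactor hn hM
  refine Valuation.map_sub_lt_trans h1 ?_
  rw [← h.dworkFactor_mul_closedForm, mul_assoc]
  refine Valuation.map_mul_sub_mul_lt ?_ (h3.map_eq.trans hD).le ?_ ?_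
  · rw [map_mul, h.pow_of_mul.map_closedForm hM, one_mul]
    exact hW
  · rw [Valuation.map_sub_swap]
    exact h3.map_sub_lt_one hD.le
  · rw [Valuation.map_sub_swap]
    exact h2

end ReducesToRootOfUnity

/-! ### The `Φ_m`-adic valuation, built over `ℚ[X]` because `ℤ[X]` is not a Dedekind domain. -/

section CyclotomicValuation

open WithZero IsDedekindDomain

/-- The inclusion of the field of rational functions over `ℤ` into the one over `ℚ`. -/
noncomputable def ratFuncIntToRat : RatFunc ℤ →+* RatFunc ℚ :=
  IsFractionRing.map (A := ℤ[X]) (B := ℚ[X]) (j := mapRingHom (Int.castRingHom ℚ))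
    (Polynomial.map_injective _ Int.cast_injective)

lemma ratFuncIntToRat_algebraMap (f : ℤ[X]) :
    ratFuncIntToRat (algebraMap ℤ[X] (RatFunc ℤ) f)
      = algebraMap ℚ[X] (RatFunc ℚ) (f.map (Int.castRingHom ℚ)) :=
  IsLocalization.map_eq (M := nonZeroDivisors ℤ[X]) (S := RatFunc ℤ) (T := nonZeroDivisors ℚ[X])
    (Q := RatFunc ℚ) (g := mapRingHom (Int.castRingHom ℚ))
    (nonZeroDivisors_le_comap_nonZeroDivisors_of_injective _
      (Polynomial.map_injective _ Int.cast_injective)) f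

/-- The prime of `ℚ[X]` generated by a cyclotomic polynomial. -/
noncomputable def cyclotomicPrime (m : ℕ) [NeZero m] : HeightOneSpectrum ℚ[X] where
  asIdeal := Ideal.span {cyclotomic m ℚ}
  isPrime := (Ideal.span_singleton_prime (cyclotomic_ne_zero m ℚ)).2
    (cyclotomic.irreducible_rat (NeZero.pos m)).prime
  ne_bot := by simp [cyclotomic_ne_zero]

/-- The valuation on rational functions over `ℤ` given by the order at a cyclotomic polynomial. -/
noncomputable def cyclotomicValuation (m : ℕ) [NeZero m] :
    Valuation (RatFunc ℤ) (WithZero (Multiplicative ℤ)) :=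
  ((cyclotomicPrime m).valuation (RatFunc ℚ)).comap ratFuncIntToRat

variable (m : ℕ) [NeZero m]

lemma cyclotomicValuation_algebraMap (f : ℤ[X]) :
    cyclotomicValuation m (algebraMap ℤ[X] (RatFunc ℤ) f)
      = (cyclotomicPrime m).intValuation (f.map (Int.castRingHom ℚ)) := by
  rw [cyclotomicValuation, Valuation.comap_apply, ratFuncIntToRat_algebraMap,
    HeightOneSpectrum.valuation_of_algebraMap]

lemma cyclotomicValuation_algebraMap_le_one (f : ℤ[X]) :
    cyclotomicValuation m (algebraMap ℤ[X] (RatFunc ℤ) f) ≤ 1 := by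
  rw [cyclotomicValuation_algebraMap]
  exact HeightOneSpectrum.intValuation_le_one _ _

lemma cyclotomicValuation_algebraMap_le_exp_iff (f : ℤ[X]) (e : ℕ) :
    cyclotomicValuation m (algebraMap ℤ[X] (RatFunc ℤ) f) ≤ exp (-(e : ℤ))
      ↔ cyclotomic m ℤ ^ e ∣ f := by
  rw [cyclotomicValuation_algebraMap, HeightOneSpectrum.intValuation_le_pow_iff_dvd,
    -- Gauss's lemma: `Φ_m ^ e` is monic, so divisibility over `ℚ` descends to `ℤ`.
    IsPrimitive.Int.dvd_iff_map_cast_dvd_map_cast _ _ ((cyclotomic.monic m ℤ).pow e).isPrimitive,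
    Polynomial.map_pow, map_cyclotomic]
  simp only [cyclotomicPrime]
  rw [Ideal.span_singleton_pow, Ideal.dvd_span_singleton, Ideal.mem_span_singleton]

lemma WithZero.lt_exp_iff_le_exp_sub_one (x : WithZero (Multiplicative ℤ)) (a : ℤ) :
    x < exp a ↔ x ≤ exp (a - 1) := by
  rw [← lt_mul_exp_iff_le exp_ne_zero, ← exp_add, sub_add_cancel]

lemma cyclotomicValuation_algebraMap_eq_one {f : ℤ[X]} (hf : ¬ cyclotomic m ℤ ∣ f) :
    cyclotomicValuation m (algebraMap ℤ[X] (RatFunc ℤ) f) = 1 := by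
  refine le_antisymm (cyclotomicValuation_algebraMap_le_one m f) (not_lt.1 fun h => hf ?_)
  rw [← exp_zero, WithZero.lt_exp_iff_le_exp_sub_one] at h
  simpa using (cyclotomicValuation_algebraMap_le_exp_iff m f 1).1 (by simpa using h)

/-- The denominator has valuation at most one, so the numerator has valuation at most that of `x`.
By discreteness, the strict bound `exp (1 - e)` means order at least `e`. -/
lemma cyclotomic_pow_dvd_num {x : RatFunc ℤ} {e : ℕ}
    (h : cyclotomicValuation m x < exp (1 - (e : ℤ))) :
    cyclotomic m ℤ ^ e ∣ IsFractionRing.num ℤ[X] x := by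
  rw [← cyclotomicValuation_algebraMap_le_exp_iff m]
  have hx := IsFractionRing.mk'_num_den' ℤ[X] x
  have hd : algebraMap ℤ[X] (RatFunc ℤ) (IsFractionRing.den ℤ[X] x) ≠ 0 := by simp
  rw [div_eq_iff hd] at hx
  rw [WithZero.lt_exp_iff_le_exp_sub_one, show 1 - (e : ℤ) - 1 = -e by ring] at h
  rw [hx, map_mul]
  exact (mul_le_of_le_one_right' (cyclotomicValuation_algebraMap_le_one m _)).trans h

lemma aeval_eq_zero_of_cyclotomic_dvd {f : ℤ[X]} (hf : cyclotomic m ℤ ∣ f) {ζ : ℂ}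
    (hζ : IsPrimitiveRoot ζ m) : aeval ζ f = 0 := by
  obtain ⟨g, rfl⟩ := hf
  have h := hζ.isRoot_cyclotomic (NeZero.pos m)
  rw [← map_cyclotomic m (algebraMap ℤ ℂ), IsRoot.def, eval_map_algebraMap] at h
  rw [map_mul, h, zero_mul]

/-- The elements claimed to be units are polynomials that do not vanish at a primitive complex
`m`-th root of unity, hence are not divisible by `Φ_m`. -/
lemma reducesToRootOfUnity_X (hm : Odd m) :
    ReducesToRootOfUnity (cyclotomicValuation m) (RatFunc.X : RatFunc ℤ) m := by
  have hζ := Complex.isPrimitiveRoot_exp m (NeZero.ne m)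
  have hpow : ∀ t, (1 - RatFunc.X ^ t : RatFunc ℤ) = algebraMap ℤ[X] (RatFunc ℤ) (1 - X ^ t) := by
    intro t; simp
  refine ⟨hm, ?_, ?_, ?_, ?_, ?_⟩
  · rw [← RatFunc.algebraMap_X]
    refine cyclotomicValuation_algebraMap_eq_one m fun hd => ?_
    have := aeval_eq_zero_of_cyclotomic_dvd m hd hζ
    rw [aeval_X] at this
    exact hζ.ne_zero (NeZero.ne m) this
  · intro t ht
    rw [hpow]
    refine cyclotomicValuation_algebraMap_eq_one m fun hd => ht ?_
    have := aeval_eq_zero_of_cyclotomic_dvd m hd hζ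
    simp only [map_sub, map_one, map_pow, aeval_X] at this
    exact hζ.dvd_of_pow_eq_one t (sub_eq_zero.1 this).symm
  · rw [hpow, ← exp_zero, WithZero.lt_exp_iff_le_exp_sub_one]
    refine (cyclotomicValuation_algebraMap_le_exp_iff m _ 1).2 ?_
    rw [pow_one, ← neg_sub, dvd_neg]
    exact cyclotomic.dvd_X_pow_sub_one m ℤ
  · intro t ht h
    have h1 : algebraMap ℤ[X] (RatFunc ℤ) (X ^ t) = algebraMap ℤ[X] (RatFunc ℤ) 1 := by simpa using h
    have h2 := congrArg (Polynomial.eval 0) (IsFractionRing.injective ℤ[X] (RatFunc ℤ) h1)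
    simp [ht] at h2
  · intro t ht
    have h1 : (t : RatFunc ℤ) = algebraMap ℤ[X] (RatFunc ℤ) (t : ℤ[X]) := by simp
    rw [h1]
    refine cyclotomicValuation_algebraMap_eq_one m fun hd => ht ?_
    have := aeval_eq_zero_of_cyclotomic_dvd m hd hζ
    simpa using this

lemma cyclotomicValuation_one_sub_X_pow_sq_lt (hm : Odd m) :
    cyclotomicValuation m (1 - RatFunc.X ^ m) ^ 2 < exp (1 - ((2 : ℕ) : ℤ)) := by
  have h := (reducesToRootOfUnity_X m hm).map_one_sub_lt
  rw [← exp_zero, WithZero.lt_exp_iff_le_exp_sub_one] at h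
  refine lt_of_le_of_lt (pow_le_pow_left₀ zero_le h 2) ?_
  rw [← exp_nsmul, exp_lt_exp]
  norm_num

end CyclotomicValuation

/-! ### Assembly over the different cyclotomic factors. -/

lemma cyclotomic_isRelPrime {a b : ℕ} (ha : 0 < a) (hb : 0 < b) (hab : a ≠ b) :
    IsRelPrime (cyclotomic a ℤ) (cyclotomic b ℤ) := by
  refine (cyclotomic.irreducible ha).isRelPrime_iff_not_dvd.2 fun hd => hab ?_
  have h := (cyclotomic.irreducible ha).associated_of_dvd (cyclotomic.irreducible hb) hd
  exact cyclotomic_injective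
    (eq_of_monic_of_associated (cyclotomic.monic a ℤ) (cyclotomic.monic b ℤ) h)

theorem theorem1p3 (n : ℕ) (hn : n ≡ 1 [MOD 4]) (r : ℕ) (hr : 1 ≤ r)
    (d : ℕ) (hd : d = 1 ∨ d = 2) (q : RatFunc ℤ) (hq : q = RatFunc.X) :
    RatFuncCongr
      (∑ k ∈ Finset.range ((n ^ r - 1) / d + 1),
        ((1 + q ^ (4 * k + 1)) * qShifted (q ^ 2) (q ^ 4) k ^ 3)
          / ((1 + q) * qShifted (q ^ 4) (q ^ 4) k ^ 3) * q ^ k)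
      ((qInteger n (q ^ 2) * qShifted (q ^ 3) (q ^ 4) ((n ^ r - 1) / 2)
            * qShifted (q ^ (5 * n)) (q ^ (4 * n)) ((n ^ (r - 1) - 1) / 2))
          / (qShifted (q ^ 5) (q ^ 4) ((n ^ r - 1) / 2)
            * qShifted (q ^ (3 * n)) (q ^ (4 * n)) ((n ^ (r - 1) - 1) / 2))
        * q ^ ((1 - (n : ℤ)) / 2)
        * ∑ k ∈ Finset.range ((n ^ (r - 1) - 1) / d + 1),
            ((1 + q ^ ((4 * k + 1) * n)) * qShifted (q ^ (2 * n)) (q ^ (4 * n)) k ^ 3)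
              / ((1 + q ^ n) * qShifted (q ^ (4 * n)) (q ^ (4 * n)) k ^ 3) * q ^ (n * k))
      (cyclotomic (n ^ r) ℤ * ∏ j ∈ Finset.Icc 1 r, cyclotomic (n ^ j) ℤ) := by
  have hL : ∑ k ∈ Finset.range ((n ^ r - 1) / d + 1),
        ((1 + q ^ (4 * k + 1)) * qShifted (q ^ 2) (q ^ 4) k ^ 3)
          / ((1 + q) * qShifted (q ^ 4) (q ^ 4) k ^ 3) * q ^ k
      = ∑ k ∈ Finset.range ((n ^ r - 1) / d + 1), cubicSummand q k := rfl
  have hS : ∑ k ∈ Finset.range ((n ^ (r - 1) - 1) / d + 1),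
            ((1 + q ^ ((4 * k + 1) * n)) * qShifted (q ^ (2 * n)) (q ^ (4 * n)) k ^ 3)
              / ((1 + q ^ n) * qShifted (q ^ (4 * n)) (q ^ (4 * n)) k ^ 3) * q ^ (n * k)
      = ∑ k ∈ Finset.range ((n ^ (r - 1) - 1) / d + 1), cubicSummand (q ^ n) k := by
    refine Finset.sum_congr rfl fun k _ => ?_
    rw [cubicSummand, ← pow_mul, ← pow_mul, ← pow_mul, ← pow_mul, mul_comm n 2, mul_comm n 4,
      mul_comm n (4 * k + 1)]
  have hR : (qInteger n (q ^ 2) * qShifted (q ^ 3) (q ^ 4) ((n ^ r - 1) / 2)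
            * qShifted (q ^ (5 * n)) (q ^ (4 * n)) ((n ^ (r - 1) - 1) / 2))
          / (qShifted (q ^ 5) (q ^ 4) ((n ^ r - 1) / 2)
            * qShifted (q ^ (3 * n)) (q ^ (4 * n)) ((n ^ (r - 1) - 1) / 2))
        * q ^ ((1 - (n : ℤ)) / 2) = dworkFactor n (n ^ r) (n ^ (r - 1)) q := by
    rw [dworkFactor, gammaRatio, gammaRatio, ← pow_mul, ← pow_mul, ← pow_mul, mul_comm n 3,
      mul_comm n 4, mul_comm n 5, mul_div_assoc', div_div_div_eq]
  rw [hL, hS, hR, hq]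
  have hpow1 : ∀ j, n ^ j ≡ 1 [MOD 4] := fun j => by simpa using hn.pow j
  have hodd1 : ∀ {a : ℕ}, a ≡ 1 [MOD 4] → Odd a := fun {a} ha => by
    rw [Nat.odd_iff]; unfold Nat.ModEq at ha; omega
  have hn0 : n ≠ 0 := (hodd1 hn).pos.ne'
  obtain ⟨s, rfl⟩ : ∃ s, r = s + 1 := ⟨r - 1, by omega⟩
  rw [Nat.add_sub_cancel]
  -- For `n = 1` all the cyclotomic factors coincide, but the two sides are equal and the numerator
  -- is zero.
  rcases eq_or_ne n 1 with rfl | hn1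
  · have h := reducesToRootOfUnity_X 1 odd_one
    have h1 : 1 - (RatFunc.X : RatFunc ℤ) ^ 2 ≠ 0 := h.one_sub_ne_zero two_ne_zero
    simp [RatFuncCongr, dworkFactor, qInteger, gammaRatio, qShifted_zero, div_self h1,
      IsFractionRing.num_zero]
  have hinj : Function.Injective fun j => n ^ j := Nat.pow_right_injective (by omega)
  have htop : cyclotomic (n ^ (s + 1)) ℤ ^ 2 ∣ IsFractionRing.num ℤ[X]
      (∑ k ∈ Finset.range ((n ^ (s + 1) - 1) / d + 1), cubicSummand (RatFunc.X : RatFunc ℤ) k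
        - dworkFactor n (n ^ (s + 1)) (n ^ s) (RatFunc.X : RatFunc ℤ)
          * ∑ k ∈ Finset.range ((n ^ s - 1) / d + 1), cubicSummand (RatFunc.X ^ n) k) := by
    have : NeZero (n ^ (s + 1)) := ⟨pow_ne_zero _ hn0⟩
    refine cyclotomic_pow_dvd_num (n ^ (s + 1)) ?_
    have h := reducesToRootOfUnity_X _ (hodd1 (hpow1 (s + 1)))
    have hsq := cyclotomicValuation_one_sub_X_pow_sq_lt _ (hodd1 (hpow1 (s + 1)))
    generalize cyclotomicValuation (n ^ (s + 1)) = v at h hsq ⊢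
    rw [pow_succ' n s] at h hsq ⊢
    exact h.map_sum_sub_dworkFactor_mul_sum_lt hn (hpow1 s) hd hsq
  have hlow : ∀ j ∈ Finset.Icc 1 s, cyclotomic (n ^ j) ℤ ∣ IsFractionRing.num ℤ[X]
      (∑ k ∈ Finset.range ((n ^ (s + 1) - 1) / d + 1), cubicSummand (RatFunc.X : RatFunc ℤ) k
        - dworkFactor n (n ^ (s + 1)) (n ^ s) (RatFunc.X : RatFunc ℤ)
          * ∑ k ∈ Finset.range ((n ^ s - 1) / d + 1), cubicSummand (RatFunc.X ^ n) k) := by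
    intro j hj
    obtain ⟨i, rfl⟩ : ∃ i, j = i + 1 := ⟨j - 1, by have := (Finset.mem_Icc.1 hj).1; omega⟩
    obtain ⟨t, rfl⟩ := Nat.exists_eq_add_of_le (Finset.mem_Icc.1 hj).2
    have : NeZero (n ^ (i + 1)) := ⟨pow_ne_zero _ hn0⟩
    rw [← pow_one (cyclotomic (n ^ (i + 1)) ℤ)]
    refine cyclotomic_pow_dvd_num (n ^ (i + 1)) ?_
    have h := reducesToRootOfUnity_X _ (hodd1 (hpow1 (i + 1)))
    generalize cyclotomicValuation (n ^ (i + 1)) = v at h ⊢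
    rw [pow_succ' n i] at h
    -- Here the period is `n ^ (i + 1)` in base `q` and `n ^ i` in base `q ^ n`, with `L = n ^ (t +
    -- 1)` periods.
    have key := h.map_sum_sub_dworkFactor_mul_sum_lt_one hn (hpow1 i)
      (hodd1 (hpow1 (t + 1))) hd
    have e1 : n * n ^ i * n ^ (t + 1) = n ^ (i + 1 + t + 1) := by ring
    have e2 : n ^ i * n ^ (t + 1) = n ^ (i + 1 + t) := by ring
    rw [e1, e2] at key
    simpa using key
  -- The top factor of the product joins the extra one to form the square.
  rw [RatFuncCongr, Finset.prod_Icc_succ_top (by omega), mul_left_comm, ← pow_two, mul_comm]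
  refine IsRelPrime.mul_dvd (IsRelPrime.prod_right fun j hj => IsRelPrime.pow_left ?_) htop
    (Finset.prod_dvd_of_isRelPrime (fun i _ j _ hij => ?_) hlow)
  · refine cyclotomic_isRelPrime (by positivity) (by positivity) fun h => ?_
    have := hinj h
    have := (Finset.mem_Icc.1 hj).2
    omega
  · exact cyclotomic_isRelPrime (by positivity) (by positivity) fun h => hij (hinj h)
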